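/- Let $k\ge 0$, $n_1,\dots,n_k\ge 0$ be integers and $q_1,\dots,q_k\in\mathbb C^\times$, and let $\mathcal H=\mathcal H(n_1,q_1)\otimes_{\mathbb C}\cdots\otimes_{\mathbb C}\mathcal H(n_k,q_k)$. Here $\mathcal H(n,q)$ is the affine Hecke algebra of type A: the $\mathbb C$-algebra generated by $T_1,\dots,T_{n-1}$ and $y_1^{\pm1},\dots,y_n^{\pm1}$, where the $y_j$ commute with each other, $T_iT_{i+1}T_i=T_{i+1}T_iT_{i+1}$, $T_iT_j=T_jT_i$ for $|i-j|>1$, $(T_i-q)(T_i+1)=0$, $T_iy_iT_i=q\,y_{i+1}$, and $T_iy_j=y_jT_i$ for $j\ne i,i+1$. (Every Bernstein block of $\mathrm{GL}_m(F)$, $F$ a non-archimedean local field, is equivalent to the category of modules over such an algebra $\mathcal H$, and its finitely generated representations are viewed as finitely generated $\mathcal H$-modules.) Let $\mathcal Z$ be the centre of $\mathcal H$, $\mathcal J\subset\mathcal Z$ a maximal ideal, and $\widehat{\mathcal Z}=\varprojlim_i \mathcal Z/\mathcal J^i$. For an $\mathcal H$-module $\tau$ put $\widehat\tau=\varprojlim_i\tau/\mathcal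 J^i\tau$; this is an $\mathcal H$-module on which $\widehat{\mathcal Z}$ acts by $\mathcal H$-endomorphisms. Let $\widehat{\mathcal C}(\mathcal J)$ be the full subcategory of the category of $\mathcal H$-modules whose objects are the modules isomorphic to $\widehat\tau$ for some $\mathcal H$-module $\tau$ such that $\tau/\mathcal J^i\tau$ has finite length for all $i$. Let $\pi_1,\pi_2$ be finitely generated $\mathcal H$-modules. Then $\widehat{\mathcal C}(\mathcal J)$ is an abelian category, $\widehat\pi_1$ and $\widehat\pi_2$ are objects of it, and for every $i\ge0$ there are isomorphisms of $\widehat{\mathcal Z}$-modules $$\mathrm{Ext}^i_{\mathcal H}(\pi_1,\widehat\pi_2)\;\cong\;\widehat{\mathcal Z}\otimes_{\mathcal Z}\mathrm{Ext}^i_{\mathcal H}(\pi_1,\pi_2)\;\cong\;\mathrm{Ext}^i_{\widehat{\mathcal C}(\mathcal J)}(\widehat\pi_1,\widehat\pi_2),$$ where $\widehat{\mathcal Z}$ acts on the outer terms through $\widehat\pi_2$ and $\mathcal Z$ acts on $\mathrm{Ext}^i_{\mathcal H}(\pi_1,\pi_2)$ through $\pi_2$. Suppose moreover that at least one of $\pi_1,\pi_2$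 has finite length and belongs to $\widehat{\mathcal C}(\mathcal J)$. If $\dim_{\mathbb C}\mathrm{Ext}^i_{\mathcal H}(\pi_1,\pi_2)<\infty$, then there is an isomorphism of $\mathcal Z$-modules $$\mathrm{Ext}^i_{\mathcal H}(\pi_1,\pi_2)\;\cong\;\mathrm{Ext}^i_{\widehat{\mathcal C}(\mathcal J)}(\widehat\pi_1,\widehat\pi_2).$$ -/

import Mathlib

open CategoryTheory CategoryTheory.Abelian
open scoped TensorProduct

/-! ### Affine Hecke algebras of type A -/

/-- Generators of the affine Hecke algebra `𝓗(n, q)`: `T i` for `0 ≤ i < n - 1`, and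
`y j`, `yInv j` for `0 ≤ j < n` (indices start at `0`). -/
inductive AffineHeckeGen (n : ℕ) : Type
  | T (i : ℕ) (hi : i + 1 < n) : AffineHeckeGen n
  | y (j : Fin n) : AffineHeckeGen n
  | yInv (j : Fin n) : AffineHeckeGen n

namespace AffineHeckeGen

/-- The generator `T i` in the free algebra. -/
noncomputable abbrev fT {n : ℕ} (i : ℕ) (hi : i + 1 < n) : FreeAlgebra ℂ (AffineHeckeGen n) :=
  FreeAlgebra.ι ℂ (T i hi)

/-- The generator `y j` in the free algebra. -/
noncomputable abbrev fy {n : ℕ} (j : Fin n) : FreeAlgebra ℂ (AffineHeckeGen n) :=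
  FreeAlgebra.ι ℂ (y j)

/-- The generator `(y j)⁻¹` in the free algebra. -/
noncomputable abbrev fyInv {n : ℕ} (j : Fin n) : FreeAlgebra ℂ (AffineHeckeGen n) :=
  FreeAlgebra.ι ℂ (yInv j)

end AffineHeckeGen

open AffineHeckeGen in
/-- The defining relations of `𝓗(n, q)`. -/
inductive AffineHeckeRel (n : ℕ) (q : ℂˣ) :
    FreeAlgebra ℂ (AffineHeckeGen n) → FreeAlgebra ℂ (AffineHeckeGen n) → Prop
  | braid (i : ℕ) (hi : i + 1 + 1 < n) :
      AffineHeckeRel n q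
        (fT i (Nat.lt_of_succ_lt hi) * fT (i + 1) hi * fT i (Nat.lt_of_succ_lt hi))
        (fT (i + 1) hi * fT i (Nat.lt_of_succ_lt hi) * fT (i + 1) hi)
  | quadratic (i : ℕ) (hi : i + 1 < n) :
      AffineHeckeRel n q
        ((fT i hi - algebraMap ℂ _ (q : ℂ)) * (fT i hi + 1)) 0
  | T_comm (i j : ℕ) (hi : i + 1 < n) (hj : j + 1 < n) (hij : i + 1 < j) :
      AffineHeckeRel n q (fT i hi * fT j hj) (fT j hj * fT i hi)
  | y_comm (j l : Fin n) : AffineHeckeRel n q (fy j * fy l) (fy l * fy j)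
  | y_mul_yInv (j : Fin n) : AffineHeckeRel n q (fy j * fyInv j) 1
  | yInv_mul_y (j : Fin n) : AffineHeckeRel n q (fyInv j * fy j) 1
  | T_y_T (i : ℕ) (hi : i + 1 < n) :
      AffineHeckeRel n q
        (fT i hi * fy ⟨i, Nat.lt_of_succ_lt hi⟩ * fT i hi)
        (algebraMap ℂ _ (q : ℂ) * fy ⟨i + 1, hi⟩)
  | T_y_comm (i : ℕ) (hi : i + 1 < n) (j : Fin n) (h₀ : (j : ℕ) ≠ i) (h₁ : (j : ℕ) ≠ i + 1) :
      AffineHeckeRel n q (fT i hi * fy j) (fy j * fT i hi)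

/-- The affine Hecke algebra `𝓗(n, q)` of type A over `ℂ`, by generators and relations. -/
abbrev AffineHecke (n : ℕ) (q : ℂˣ) : Type := RingQuot (AffineHeckeRel n q)

/-- The Hecke algebra `𝓗(n₁, q₁) ⊗ ⋯ ⊗ 𝓗(n_k, q_k)` attached to a Bernstein block. -/
abbrev BlockHecke {k : ℕ} (n : Fin k → ℕ) (q : Fin k → ℂˣ) : Type :=
  ⨂[ℂ] i, AffineHecke (n i) (q i)

/-! ### Completion of modules at an ideal of the centre -/

section Completion

variable {A : Type} [Ring A]

/-- The centre of a ring. -/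
abbrev Zc (A : Type) [Ring A] : Subring A := Subring.center A

instance centerSMulCommClass (M : Type*) [AddCommGroup M] [Module A M] :
    SMulCommClass A (Zc A) M where
  smul_comm a z m := by
    change a • (z : A) • m = (z : A) • a • m
    rw [← mul_smul, ← mul_smul, (Subring.mem_center_iff.mp z.2 a)]

/-- `A`-modules form a category which is linear over the centre of `A`. Through this instance
the groups `Ext` of `A`-modules are modules over the centre. -/
instance centerLinear : Linear (Zc A) (ModuleCat.{0} A) where
  homModule _ _ := inferInstance
  smul_comp _ _ _ z f g := by
    ext m
    change g.hom ((z : A) • f.hom m) = (z : A) • g.hom (f.hom m)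
    rw [map_smul]
  comp_smul _ _ _ _ _ _ := rfl

/-- The `A`-submodule `I M` of `M`, for an ideal `I` of the centre. -/
def centralSMul (I : Ideal (Zc A)) (M : Type*) [AddCommGroup M] [Module A M] :
    Submodule A M where
  carrier := (I • (⊤ : Submodule (Zc A) M) : Submodule (Zc A) M)
  add_mem' := add_mem
  zero_mem' := zero_mem _
  smul_mem' a x hx := by
    refine Submodule.smul_induction_on hx (fun z hz m _ => ?_) (fun x y hx hy => ?_)
    · change a • z • m ∈ _
      rw [smul_comm]
      exact Submodule.smul_mem_smul hz trivial
    · change a • (x + y) ∈ _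
      rw [smul_add]
      exact add_mem hx hy

/-- Multiplication by `a : A`, as a map which is linear over the centre. -/
def mulLeftCenter (a : A) (M : Type*) [AddCommGroup M] [Module A M] : M →ₗ[Zc A] M where
  toFun m := a • m
  map_add' := smul_add a
  map_smul' z m := smul_comm a z m

variable (J : Ideal (Zc A))

/-- The `A`-module structure on `lim M / Jⁱ M`, where `a` acts by multiplication by `a` on each
`M / Jⁱ M`. -/
@[reducible]
noncomputable def completionModule (M : Type*) [AddCommGroup M] [Module A M] :
    Module A (AdicCompletion J M) where
  smul a x := AdicCompletion.map J (mulLeftCenter a M) x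
  one_smul x := by
    change AdicCompletion.map J (mulLeftCenter 1 M) x = x
    have : mulLeftCenter (1 : A) M = LinearMap.id := by ext m; exact one_smul A m
    rw [this, AdicCompletion.map_id]; rfl
  mul_smul a b x := by
    change AdicCompletion.map J (mulLeftCenter (a * b) M) x =
      AdicCompletion.map J (mulLeftCenter a M) (AdicCompletion.map J (mulLeftCenter b M) x)
    rw [AdicCompletion.map_comp_apply]
    congr 2
    ext m
    exact mul_smul a b m
  smul_zero a := map_zero (AdicCompletion.map J (mulLeftCenter a M))
  smul_add a x y := map_add (AdicCompletion.map J (mulLeftCenter a M)) x y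
  add_smul a b x := by
    change AdicCompletion.map J (mulLeftCenter (a + b) M) x =
      AdicCompletion.map J (mulLeftCenter a M) x + AdicCompletion.map J (mulLeftCenter b M) x
    induction x using AdicCompletion.induction_on with
    | h x =>
      rw [AdicCompletion.map_mk, AdicCompletion.map_mk, AdicCompletion.map_mk, ← map_add]
      congr 1
      ext i
      exact add_smul a b (x i)
  zero_smul x := by
    change AdicCompletion.map J (mulLeftCenter 0 M) x = 0
    have : mulLeftCenter (0 : A) M = 0 := by ext m; exact zero_smul A m
    rw [this, AdicCompletion.map_zero]; rfl

/-- The completion `π̂ = lim π / Jⁱ π` as an `A`-module. -/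
noncomputable def completion (M : ModuleCat.{0} A) : ModuleCat.{0} A :=
  letI := completionModule J M
  ModuleCat.of A (AdicCompletion J M)

/-- The completion `Ẑ` of the centre at `J`. -/
abbrev ZHat : Type := AdicCompletion J (Zc A)

/-- The action of `r : Ẑ` on `π̂`, as an endomorphism of the `A`-module `π̂`. -/
noncomputable def completionScalar (M : ModuleCat.{0} A) (r : ZHat J) :
    completion J M ⟶ completion J M :=
  letI := completionModule J M
  ModuleCat.ofHom (X := AdicCompletion J M) (Y := AdicCompletion J M)
    { toFun := fun x => r • x
      map_add' := smul_add r
      map_smul' := fun a x =>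
        ((AdicCompletion.map J (mulLeftCenter a M)).map_smul r x).symm }

/-- The objects of `Ĉ(J)`, regarded as `A`-modules: those of the form `lim τ / Jⁱ τ` for an
`A`-module `τ` all of whose quotients `τ / Jⁱ τ` have finite length. -/
def IsCHat : ObjectProperty (ModuleCat.{0} A) := fun M =>
  ∃ τ : ModuleCat.{0} A, (∀ i : ℕ, IsFiniteLength A (τ ⧸ centralSMul (J ^ i) τ)) ∧
    Nonempty (M ≅ completion J τ)

/-- The category `Ĉ(J)`, a full subcategory of the category of `A`-modules. -/
abbrev CHat : Type 1 := (IsCHat J).FullSubcategory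

/-- The completion of `M` as an object of `Ĉ(J)`. -/
noncomputable abbrev completionObj (M : ModuleCat.{0} A) (h : IsCHat J (completion J M)) :
    CHat J :=
  ⟨completion J M, h⟩

/-- The action of `r : Ẑ` on `π̂`, as an endomorphism in `Ĉ(J)`. -/
noncomputable def completionObjScalar (M : ModuleCat.{0} A) (h : IsCHat J (completion J M))
    (r : ZHat J) : completionObj J M h ⟶ completionObj J M h :=
  ObjectProperty.homMk (completionScalar J M r)

end Completion

/-!
Bernstein's argument makes `𝓗` finite over a Noetherian central subring: the symmetric functions in
the `y j`, and those in their inverses, commute with every `T i`, because `T i` interchanges two of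
the `y j` up to lower order terms, and the `T i` generate a finite-dimensional subalgebra. Hence the
centre `Z` is Noetherian and `𝓗` is a finite `Z`-module; nothing else about `𝓗` matters.

Completion at `J` is then exact on finite `𝓗`-modules, and there are natural isomorphisms
`Ẑ ⊗ Hom(M, N) ≅ Hom(M, N̂) ≅ Hom(M̂, N̂)` for `M` finite: the first holds for free `M`, hence for
all finite `M` by flatness of `Ẑ`, the second because `N̂` is `J`-adically complete. Completed free
modules of finite rank are projective in `Ĉ(J)`, so a presentation `0 ⟶ K ⟶ 𝓗ⁿ ⟶ M ⟶ 0` and its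
completion shift dimensions simultaneously in the three families of groups `Ext`, which extends the
isomorphisms to all degrees.

If `M` or `N` has finite length and lies in `Ĉ(J)`, it is killed by a power of `J`. Hence so is
`Ext(M, N)`, and tensoring with `Ẑ` does not change it.
-/

section AdicCompletionRing

variable {R S : Type*} [CommRing R] [CommRing S] {I : Ideal R} {J : Ideal S} {f : R →+* S}

theorem pow_le_comap_pow_of_map_le (h : I.map f ≤ J) (n : ℕ) : I ^ n ≤ (J ^ n).comap f := by
  rw [← Ideal.map_le_iff_le_comap, Ideal.map_pow]
  exact Ideal.pow_right_mono h n

/-- The map from the adic completion of `R` at `I` to `S ⧸ J ^ n` induced by a ring homomorphism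
`R →+* S` which carries `I` into `J`. -/
noncomputable def adicCompletionToQuotientPow (f : R →+* S) (h : I.map f ≤ J) (n : ℕ) :
    AdicCompletion I R →+* S ⧸ J ^ n :=
  (Ideal.quotientMap (J ^ n) f (pow_le_comap_pow_of_map_le h n)).comp
    (AdicCompletion.evalₐ I n).toRingHom

theorem factorPow_comp_adicCompletionToQuotientPow (h : I.map f ≤ J) {m n : ℕ} (hmn : m ≤ n) :
    (Ideal.Quotient.factorPow J hmn).comp (adicCompletionToQuotientPow f h n) =
      adicCompletionToQuotientPow f h m := by
  ext x
  induction x using AdicCompletion.induction_on with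
  | h x =>
    simp only [adicCompletionToQuotientPow, RingHom.comp_apply, AlgHom.toRingHom_eq_coe,
      RingHom.coe_coe, AdicCompletion.evalₐ_mk, Ideal.quotientMap_mk, Ideal.Quotient.factorPow,
      Ideal.Quotient.factor_mk, Ideal.Quotient.eq, ← map_sub]
    exact pow_le_comap_pow_of_map_le h m
      (Ideal.Quotient.eq.1 (AdicCompletion.Ideal.mk_eq_mk _ hmn x))

/-- The map between the adic completions at `I` and at `J` induced by a ring homomorphism which
carries `I` into `J`. -/
noncomputable def adicCompletionRingHom (f : R →+* S) (h : I.map f ≤ J) :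
    AdicCompletion I R →+* AdicCompletion J S :=
  AdicCompletion.liftRingHom J (adicCompletionToQuotientPow f h)
    (factorPow_comp_adicCompletionToQuotientPow h)

theorem adicCompletionRingHom_algebraMap (h : I.map f ≤ J) (x : R) :
    adicCompletionRingHom f h (algebraMap R _ x) = algebraMap S _ (f x) :=
  AdicCompletion.ext_evalₐ fun n => AdicCompletion.evalₐ_liftRingHom J _
    (factorPow_comp_adicCompletionToQuotientPow h) n _

theorem adicCompletionRingHom_surjective (hf : Function.Surjective f) (hI : I.FG)
    (h : I.map f = J) : Function.Surjective (adicCompletionRingHom f h.le) := by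
  set F := adicCompletionRingHom f h.le
  set K := I.map (algebraMap R (AdicCompletion I R))
  have map_K : K.map F = J.map (algebraMap S (AdicCompletion J S)) := by
    rw [Ideal.map_map, (RingHom.ext (adicCompletionRingHom_algebraMap h.le) :
      F.comp (algebraMap R _) = (algebraMap S _).comp f), ← Ideal.map_map, h]
  have : IsAdicComplete K (AdicCompletion I R) :=
    (IsAdicComplete.map_algebraMap_iff I _).2 (AdicCompletion.isAdicComplete hI)
  have : IsHausdorff (K.map F) (AdicCompletion J S) := by
    rw [map_K, IsHausdorff.map_algebraMap_iff]
    infer_instance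
  refine surjective_of_mk_map_comp_surjective (I := K) F fun y => ?_
  obtain ⟨y, rfl⟩ := Ideal.Quotient.mk_surjective y
  obtain ⟨s, hs⟩ := Ideal.Quotient.mk_surjective (AdicCompletion.evalOneₐ J y)
  obtain ⟨r, rfl⟩ := hf s
  refine ⟨algebraMap R _ r, ?_⟩
  rw [RingHom.comp_apply, Ideal.Quotient.eq, map_K,
    ← AdicCompletion.ker_evalOneₐ_eq_map J (h ▸ hI.map f), RingHom.mem_ker,
    adicCompletionRingHom_algebraMap, map_sub, sub_eq_zero]
  exact hs

-- `R̂` is a quotient of a power series ring in as many variables as `I` has generators.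
instance isNoetherianRing_adicCompletion [IsNoetherianRing R] (I : Ideal R) :
    IsNoetherianRing (AdicCompletion I R) := by
  obtain ⟨s, hs⟩ := IsNoetherian.noetherian I
  let F : MvPolynomial s R →+* R := (MvPolynomial.aeval (R := R) Subtype.val).toRingHom
  have map_F : (MvPolynomial.idealOfVars s R).map F = I := by
    rw [MvPolynomial.idealOfVars, Ideal.map_span, ← Set.range_comp, ← hs]
    congr 1
    ext
    simp [F]
  have : IsNoetherianRing (AdicCompletion (MvPolynomial.idealOfVars s R) (MvPolynomial s R)) :=
    isNoetherianRing_of_ringEquiv _ (MvPowerSeries.toAdicCompletionAlgEquiv s R).toRingEquiv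
  exact isNoetherianRing_of_surjective _ _ _ (adicCompletionRingHom_surjective (f := F)
    (fun r => ⟨MvPolynomial.C r, by simp [F]⟩) (MvPolynomial.idealOfVars_fg _ _) map_F)

end AdicCompletionRing

section AdicCompletionModule

variable {R : Type*} [CommRing R] {I : Ideal R}
variable {M N : Type*} [AddCommGroup M] [Module R M] [AddCommGroup N] [Module R N]

variable (I M)

theorem isPrecomplete_of_finite [IsPrecomplete I R] [Module.Finite R M] : IsPrecomplete I M := by
  rw [← AdicCompletion.of_surjective_iff]
  intro x
  obtain ⟨t, rfl⟩ := AdicCompletion.ofTensorProduct_surjective_of_finite I M x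
  induction t using TensorProduct.induction_on with
  | zero => exact ⟨0, by simp⟩
  | tmul r m =>
    obtain ⟨s, rfl⟩ := AdicCompletion.of_surjective I R r
    refine ⟨s • m, ?_⟩
    rw [AdicCompletion.ofTensorProduct_tmul, map_smul]
    exact (algebraMap_smul (AdicCompletion I R) s _).symm
  | add t u ht hu =>
    obtain ⟨m, hm⟩ := ht
    obtain ⟨m', hm'⟩ := hu
    exact ⟨m + m', by rw [map_add, map_add, hm, hm']⟩

theorem isAdicComplete_of_finite [IsNoetherianRing R] [IsAdicComplete I R] [Module.Finite R M] :
    IsAdicComplete I M where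
  toIsHausdorff := IsHausdorff.of_le_jacobson I M (IsAdicComplete.le_jacobson_bot I)
  toIsPrecomplete := isPrecomplete_of_finite I M

theorem isAdicComplete_of_finite_adicCompletion [IsNoetherianRing R]
    [Module (AdicCompletion I R) M] [IsScalarTower R (AdicCompletion I R) M]
    [Module.Finite (AdicCompletion I R) M] : IsAdicComplete I M := by
  have : IsAdicComplete (I.map (algebraMap R (AdicCompletion I R))) (AdicCompletion I R) :=
    (IsAdicComplete.map_algebraMap_iff I _).2
      (AdicCompletion.isAdicComplete (IsNoetherian.noetherian I))
  rw [← IsAdicComplete.map_algebraMap_iff (S := AdicCompletion I R)]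
  exact isAdicComplete_of_finite _ M

variable {I M}

theorem isArtinian_of_pow_smul_eq_zero [IsNoetherianRing R] [I.IsMaximal] [Module.Finite R M]
    (n : ℕ) (h : ∀ z ∈ I ^ n, ∀ m : M, z • m = 0) : IsArtinian R M := by
  have : Ring.KrullDimLE 0 (R ⧸ I ^ n) := by
    refine Ideal.krullDimLE_zero_quotient_iff_forall_minimalPrimes_isMaximal.2 fun P hP => ?_
    have := hP.1.1
    rwa [← Ideal.IsMaximal.eq_of_le ‹I.IsMaximal› this.ne_top (this.le_of_pow_le hP.1.2)]
  have : IsArtinianRing (R ⧸ I ^ n) :=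
    isArtinianRing_iff_isNoetherianRing_krullDimLE_zero.2 ⟨inferInstance, this⟩
  have torsion : Module.IsTorsionBySet R M ((I ^ n : Ideal R) : Set R) := fun m z => h z z.2 m
  let _ := torsion.module
  have := torsion.isScalarTower (S := R)
  have : Module.Finite (R ⧸ I ^ n) M := Module.Finite.of_restrictScalars_finite R _ _
  exact isArtinian_of_surjective_algebraMap (S := R) (R := R ⧸ I ^ n) Ideal.Quotient.mk_surjective

theorem exists_sub_of_mem_pow_smul_top (hI : I.FG) (x : AdicCompletion I M) (n : ℕ) :
    ∃ m : M, x - AdicCompletion.of I M m ∈ (I ^ n • ⊤ : Submodule R (AdicCompletion I M)) := by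
  obtain ⟨m, hm⟩ := Submodule.mkQ_surjective _ (AdicCompletion.eval I M n x)
  refine ⟨m, ?_⟩
  rw [AdicCompletion.pow_smul_top_eq_ker_eval hI, LinearMap.mem_ker, map_sub, sub_eq_zero]
  exact hm.symm

theorem eq_of_comp_of_eq [IsHausdorff I N] (hI : I.FG) {f g : AdicCompletion I M →ₗ[R] N}
    (h : f ∘ₗ AdicCompletion.of I M = g ∘ₗ AdicCompletion.of I M) : f = g := by
  refine LinearMap.ext fun x => (IsHausdorff.eq_iff_smodEq (I := I)).2 fun n => SModEq.sub_mem.2 ?_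
  obtain ⟨m, hm⟩ := exists_sub_of_mem_pow_smul_top hI x n
  have : f x - g x = (f - g) (x - AdicCompletion.of I M m) := by
    have : f (AdicCompletion.of I M m) = g (AdicCompletion.of I M m) := LinearMap.congr_fun h m
    rw [map_sub, LinearMap.sub_apply, LinearMap.sub_apply, this, sub_self, sub_zero]
  exact this ▸ Submodule.smul_top_le_comap_smul_top _ (f - g) hm

theorem finite_adicCompletion_of_finite_quotient [Module.Finite R (M ⧸ (I • ⊤ : Submodule R M))] :
    Module.Finite (AdicCompletion I R) (AdicCompletion I M) := by
  obtain ⟨n, f, hf⟩ := Module.Finite.exists_fin' R (M ⧸ (I • ⊤ : Submodule R M))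
  obtain ⟨g, hg⟩ := Module.projective_lifting_property (Submodule.mkQ _) f
    (Submodule.mkQ_surjective _)
  have : Module.Finite (AdicCompletion I R) (AdicCompletion I (Fin n → R)) :=
    Module.Finite.equiv (AdicCompletion.piEquivFin I n).symm
  exact Module.Finite.of_surjective _
    (AdicCompletion.map_surjective_of_mkQ_comp_surjective (I := I) (f := g) (hg ▸ hf))

section Tower

variable [Module (AdicCompletion I R) M] [IsScalarTower R (AdicCompletion I R) M]

theorem smul_mem_pow_smul_top {n : ℕ} {s : AdicCompletion I R}
    (hs : s ∈ (I ^ n • ⊤ : Submodule R (AdicCompletion I R))) (m : M) :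
    s • m ∈ (I ^ n • ⊤ : Submodule R M) :=
  Submodule.smul_top_le_comap_smul_top (I ^ n)
    ((LinearMap.toSpanSingleton (AdicCompletion I R) M m).restrictScalars R) hs

variable (M) in
theorem finite_quotient_pow_smul_top (hI : I.FG) [Module.Finite (AdicCompletion I R) M] (n : ℕ) :
    Module.Finite R (M ⧸ (I ^ n • ⊤ : Submodule R M)) := by
  obtain ⟨s, hs⟩ := Module.Finite.fg_top (R := AdicCompletion I R) (M := M)
  let mk := (I ^ n • ⊤ : Submodule R M).mkQ
  have mk_mem (m : M) : mk m ∈ Submodule.span R (mk '' s) := by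
    have hm : m ∈ Submodule.span (AdicCompletion I R) (s : Set M) := hs ▸ trivial
    induction hm using Submodule.closure_induction with
    | zero => exact map_zero mk ▸ zero_mem _
    | add x y _ _ hx hy => exact map_add mk x y ▸ add_mem hx hy
    | smul_mem r x hx =>
      obtain ⟨z, hz⟩ := exists_sub_of_mem_pow_smul_top hI r n
      have : mk (r • x) = z • mk x := by
        rw [← map_smul, ← sub_eq_zero, ← map_sub, ← algebraMap_smul (AdicCompletion I R) z x,
          ← sub_smul]
        exact (Submodule.Quotient.mk_eq_zero _).2 (smul_mem_pow_smul_top hz x)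
      exact this ▸ Submodule.smul_mem _ _ (Submodule.subset_span ⟨x, hx, rfl⟩)
  refine ⟨Submodule.fg_def.2 ⟨mk '' s, s.finite_toSet.image _, eq_top_iff.2 fun x _ => ?_⟩⟩
  obtain ⟨m, rfl⟩ := Submodule.mkQ_surjective _ x
  exact mk_mem m

theorem map_adicCompletion_smul [Module (AdicCompletion I R) N]
    [IsScalarTower R (AdicCompletion I R) N] [IsHausdorff I N] (hI : I.FG) (f : M →ₗ[R] N)
    (r : AdicCompletion I R) (m : M) : f (r • m) = r • f m := by
  refine (IsHausdorff.eq_iff_smodEq (I := I)).2 fun n => SModEq.sub_mem.2 ?_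
  obtain ⟨z, hz⟩ := exists_sub_of_mem_pow_smul_top hI r n
  have : f (r • m) - r • f m =
      f ((r - algebraMap _ _ z) • m) - (r - algebraMap _ _ z) • f m := by
    rw [sub_smul, sub_smul, map_sub, algebraMap_smul, algebraMap_smul, f.map_smul z m]
    abel
  rw [this]
  exact sub_mem (Submodule.smul_top_le_comap_smul_top _ f (smul_mem_pow_smul_top hz m))
    (smul_mem_pow_smul_top hz (f m))

end Tower

end AdicCompletionModule

section CompletionFunctor

variable {A : Type} [Ring A] (J : Ideal (Zc A))

noncomputable instance completionZHatModule (M : ModuleCat.{0} A) :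
    Module (ZHat J) (completion J M) :=
  inferInstanceAs (Module (ZHat J) (AdicCompletion J M))

/-- The identification of `completion J M` with the adic completion underlying it. -/
noncomputable def completionEquiv (M : ModuleCat.{0} A) :
    completion J M ≃ₗ[ZHat J] AdicCompletion J M :=
  LinearEquiv.refl (ZHat J) (AdicCompletion J M)

theorem completionEquiv_smul (M : ModuleCat.{0} A) (a : A) (x : completion J M) :
    completionEquiv J M (a • x) =
      AdicCompletion.map J (mulLeftCenter a M) (completionEquiv J M x) := rfl

theorem completionEquiv_center_smul (M : ModuleCat.{0} A) (z : Zc A) (x : completion J M) :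
    completionEquiv J M (z • x) = z • completionEquiv J M x := by
  have hz : mulLeftCenter (z : A) M = z • LinearMap.id := rfl
  change completionEquiv J M ((z : A) • x) = _
  rw [completionEquiv_smul, hz]
  induction completionEquiv J M x using AdicCompletion.induction_on with
  | h y => rfl

instance completion_isScalarTower (M : ModuleCat.{0} A) :
    IsScalarTower (Zc A) (ZHat J) (completion J M) where
  smul_assoc z r x := by
    apply (completionEquiv J M).injective
    rw [map_smul, completionEquiv_center_smul, map_smul, smul_assoc]

/-- The canonical map from a module to its completion. -/
noncomputable def completionOf (M : ModuleCat.{0} A) : M ⟶ completion J M :=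
  ModuleCat.ofHom (Y := completion J M)
    { toFun := fun m => (completionEquiv J M).symm (AdicCompletion.of J M m)
      map_add' := fun x y => by rw [map_add, map_add]
      map_smul' := fun a x => (AdicCompletion.map_of J (mulLeftCenter a M) x).symm }

theorem adicCompletion_map_map_mulLeftCenter {M N : Type*} [AddCommGroup M] [AddCommGroup N]
    [Module A M] [Module A N] (f : M →ₗ[A] N) (a : A) (x : AdicCompletion J M) :
    AdicCompletion.map J (f.restrictScalars (Zc A)) (AdicCompletion.map J (mulLeftCenter a M) x) =
      AdicCompletion.map J (mulLeftCenter a N)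
        (AdicCompletion.map J (f.restrictScalars (Zc A)) x) := by
  rw [AdicCompletion.map_comp_apply, AdicCompletion.map_comp_apply]
  congr 2
  ext m
  exact f.map_smul a m

/-- The morphism induced on completions. -/
noncomputable def completionMap {M N : ModuleCat.{0} A} (f : M ⟶ N) :
    completion J M ⟶ completion J N :=
  ModuleCat.ofHom (X := completion J M) (Y := completion J N)
    { toFun := fun x => (completionEquiv J N).symm
        (AdicCompletion.map J (f.hom.restrictScalars (Zc A)) (completionEquiv J M x))
      map_add' := fun x y => by rw [map_add, map_add, map_add]
      map_smul' := fun a x => adicCompletion_map_map_mulLeftCenter J f.hom a x }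

theorem completionEquiv_completionMap {M N : ModuleCat.{0} A} (f : M ⟶ N) (x : completion J M) :
    completionEquiv J N ((completionMap J f).hom x) =
      AdicCompletion.map J (f.hom.restrictScalars (Zc A)) (completionEquiv J M x) := rfl

theorem completionOf_comp_completionMap {M N : ModuleCat.{0} A} (f : M ⟶ N) :
    completionOf J M ≫ completionMap J f = f ≫ completionOf J N := by
  ext m
  exact AdicCompletion.map_of J (f.hom.restrictScalars (Zc A)) m

/-- Completion as an endofunctor of the category of `A`-modules. -/
noncomputable def completionFunctor : ModuleCat.{0} A ⥤ ModuleCat.{0} A where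
  obj M := completion J M
  map f := completionMap J f
  map_id M := by
    ext x
    apply (completionEquiv J M).injective
    rw [completionEquiv_completionMap]
    exact LinearMap.congr_fun (AdicCompletion.map_id J M) _
  map_comp {M N P} f g := by
    ext x
    apply (completionEquiv J P).injective
    rw [completionEquiv_completionMap, ModuleCat.comp_apply, completionEquiv_completionMap,
      completionEquiv_completionMap, AdicCompletion.map_comp_apply]
    rfl

theorem completion_hom_ext (hJ : J.FG) {M E : ModuleCat.{0} A} [IsHausdorff J E]
    {f g : completion J M ⟶ E} (h : completionOf J M ≫ f = completionOf J M ≫ g) : f = g := by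
  let e : AdicCompletion J M →ₗ[Zc A] completion J M :=
    (completionEquiv J M).symm.toLinearMap.restrictScalars (Zc A)
  have hfg : f.hom.restrictScalars (Zc A) ∘ₗ e = g.hom.restrictScalars (Zc A) ∘ₗ e := by
    refine eq_of_comp_of_eq hJ (LinearMap.ext fun m => ?_)
    exact congrArg (fun u : M ⟶ E => u.hom m) h
  ext x
  exact LinearMap.congr_fun hfg (completionEquiv J M x)

theorem isIso_completionOf (M : ModuleCat.{0} A) [IsAdicComplete J M] :
    IsIso (completionOf J M) :=
  (ConcreteCategory.isIso_iff_bijective (completionOf J M)).2 (AdicCompletion.of_bijective J M)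

theorem exists_completionOf_comp_eq {M E : ModuleCat.{0} A} [IsAdicComplete J E] (g : M ⟶ E) :
    ∃ f : completion J M ⟶ E, completionOf J M ≫ f = g := by
  have := isIso_completionOf J E
  refine ⟨completionMap J g ≫ inv (completionOf J E), ?_⟩
  rw [← Category.assoc, completionOf_comp_completionMap, Category.assoc, IsIso.hom_inv_id,
    Category.comp_id]

end CompletionFunctor

section ScalarExtension

variable {R : Type*} [CommRing R] {M N : Type*} [AddCommGroup M] [AddCommGroup N] [Module R M]
  [Module R N]

theorem exists_module_of_linearEquiv {S : Type*} [CommRing S] [Algebra R S] [Module S N]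
    [IsScalarTower R S N] [Module.Finite S N] (e : M ≃ₗ[R] N) :
    ∃ _ : Module S M, IsScalarTower R S M ∧ Module.Finite S M := by
  let _ : Module S M := e.toAddEquiv.module S
  have map_smul_e (s : S) (x : M) : e (s • x) = s • e x := e.apply_symm_apply _
  refine ⟨inferInstance, ⟨fun r s x => e.injective ?_⟩, ?_⟩
  · rw [map_smul_e, smul_assoc, map_smul, map_smul_e]
  · exact Module.Finite.equiv ({ e with map_smul' := map_smul_e } : M ≃ₗ[S] N).symm

/-- An `R`-linear map into a Hausdorff module, as a map which is linear over the completion. -/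
def adicCompletionLinearMap {I : Ideal R} (hI : I.FG) [Module (AdicCompletion I R) M]
    [IsScalarTower R (AdicCompletion I R) M] [Module (AdicCompletion I R) N]
    [IsScalarTower R (AdicCompletion I R) N] [IsHausdorff I N] (f : M →ₗ[R] N) :
    M →ₗ[AdicCompletion I R] N :=
  { f with map_smul' := map_adicCompletion_smul hI f }

end ScalarExtension

section Objects

variable {A : Type} [Ring A] (J : Ideal (Zc A))

theorem IsCHat.of_iso {M N : ModuleCat.{0} A} (e : M ≅ N) (h : IsCHat J M) : IsCHat J N := by
  obtain ⟨τ, hτ, ⟨f⟩⟩ := h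
  exact ⟨τ, hτ, ⟨e.symm ≪≫ f⟩⟩

/-- The reduction of a module modulo `I`, for an ideal `I` of the centre, does not depend on
whether `I M` is viewed as a submodule over the ring or over its centre. -/
def quotientCentralSMulEquiv (I : Ideal (Zc A)) (M : Type*) [AddCommGroup M] [Module A M] :
    (M ⧸ centralSMul I M) ≃ₗ[Zc A] M ⧸ (I • ⊤ : Submodule (Zc A) M) :=
  (Submodule.Quotient.restrictScalarsEquiv (Zc A) (centralSMul I M)).symm ≪≫ₗ
    Submodule.quotEquivOfEq _ _ rfl

theorem isFiniteLength_quotient_centralSMul [IsNoetherianRing (Zc A)] [J.IsMaximal] (n : ℕ)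
    (M : Type*) [AddCommGroup M] [Module A M]
    [Module.Finite (Zc A) (M ⧸ (J ^ n • ⊤ : Submodule (Zc A) M))] :
    IsFiniteLength A (M ⧸ centralSMul (J ^ n) M) := by
  let e := quotientCentralSMulEquiv (J ^ n) M
  have : IsArtinian (Zc A) (M ⧸ (J ^ n • ⊤ : Submodule (Zc A) M)) :=
    isArtinian_of_pow_smul_eq_zero n fun z hz x => by
      obtain ⟨m, rfl⟩ := Submodule.Quotient.mk_surjective _ x
      exact (Submodule.Quotient.mk_eq_zero _).2 (Submodule.smul_mem_smul hz trivial)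
  rw [isFiniteLength_iff_isNoetherian_isArtinian]
  exact ⟨isNoetherian_of_tower (Zc A) (isNoetherian_of_linearEquiv e.symm),
    isArtinian_of_tower (Zc A) (isArtinian_of_linearEquiv e.symm)⟩

theorem finite_completion_of_finite_quotient (M : ModuleCat.{0} A)
    [Module.Finite (Zc A) (M ⧸ (J • ⊤ : Submodule (Zc A) M))] :
    Module.Finite (ZHat J) (completion J M) :=
  finite_adicCompletion_of_finite_quotient (I := J) (M := M)

theorem finite_completion_of_finite [Module.Finite (Zc A) A] (M : ModuleCat.{0} A)
    [Module.Finite A M] : Module.Finite (ZHat J) (completion J M) := by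
  have : Module.Finite (Zc A) M := Module.Finite.trans A M
  exact finite_completion_of_finite_quotient J M

theorem IsCHat.exists_module_zhat [Module.Finite (Zc A) A] {M : ModuleCat.{0} A}
    (h : IsCHat J M) :
    ∃ _ : Module (ZHat J) M, IsScalarTower (Zc A) (ZHat J) M ∧ Module.Finite (ZHat J) M := by
  obtain ⟨τ, hτ, ⟨e⟩⟩ := h
  have : Module.Finite (Zc A) (τ ⧸ (J • ⊤ : Submodule (Zc A) τ)) := by
    have hτ₁ := (isFiniteLength_iff_isNoetherian_isArtinian.1 (hτ 1)).1
    rw [pow_one] at hτ₁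
    have : Module.Finite (Zc A) (τ ⧸ centralSMul J τ) := Module.Finite.trans A _
    exact Module.Finite.equiv (quotientCentralSMulEquiv J τ)
  have := finite_completion_of_finite_quotient J τ
  exact exists_module_of_linearEquiv (e.toLinearEquiv.restrictScalars (Zc A))

variable [IsNoetherianRing (Zc A)]

theorem isCHat_of_finite_zhat [J.IsMaximal] (M : ModuleCat.{0} A) [Module (ZHat J) M]
    [IsScalarTower (Zc A) (ZHat J) M] [Module.Finite (ZHat J) M] : IsCHat J M := by
  refine ⟨M, fun n => ?_, ?_⟩
  · have := finite_quotient_pow_smul_top M (IsNoetherian.noetherian J) n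
    exact isFiniteLength_quotient_centralSMul J n M
  · have := isAdicComplete_of_finite_adicCompletion J M
    have := isIso_completionOf J M
    exact ⟨asIso (completionOf J M)⟩

theorem isCHat_completion [J.IsMaximal] [Module.Finite (Zc A) A] (M : ModuleCat.{0} A)
    [Module.Finite A M] : IsCHat J (completion J M) :=
  have := finite_completion_of_finite J M
  isCHat_of_finite_zhat J _

theorem IsCHat.isAdicComplete [Module.Finite (Zc A) A] {M : ModuleCat.{0} A} (h : IsCHat J M) :
    IsAdicComplete J M := by
  obtain ⟨_, _, _⟩ := h.exists_module_zhat
  exact isAdicComplete_of_finite_adicCompletion J M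

end Objects

section Abelian

variable {A : Type} [Ring A] (J : Ideal (Zc A)) [IsNoetherianRing (Zc A)] [J.IsMaximal]

theorem isCHat_of_linearEquiv (M : ModuleCat.{0} A) {N : Type*} [AddCommGroup N] [Module (Zc A) N]
    [Module (ZHat J) N] [IsScalarTower (Zc A) (ZHat J) N] [Module.Finite (ZHat J) N]
    (e : M ≃ₗ[Zc A] N) : IsCHat J M := by
  obtain ⟨_, _, _⟩ := exists_module_of_linearEquiv (S := ZHat J) e
  exact isCHat_of_finite_zhat J M

variable [Module.Finite (Zc A) A]

theorem isCHat_ker {X Y : ModuleCat.{0} A} (f : X ⟶ Y) (hX : IsCHat J X) (hY : IsCHat J Y) :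
    IsCHat J (ModuleCat.of A (LinearMap.ker f.hom)) := by
  have := hY.isAdicComplete J
  obtain ⟨_, _, _⟩ := hX.exists_module_zhat
  obtain ⟨_, _, _⟩ := hY.exists_module_zhat
  let g := adicCompletionLinearMap (IsNoetherian.noetherian J) (f.hom.restrictScalars (Zc A))
  exact isCHat_of_linearEquiv J _ (N := LinearMap.ker g)
    { toFun := fun x => ⟨x.1, x.2⟩
      invFun := fun x => ⟨x.1, x.2⟩
      map_add' := fun _ _ => rfl
      map_smul' := fun _ _ => rfl }

theorem isCHat_quotient_range {X Y : ModuleCat.{0} A} (f : X ⟶ Y) (hX : IsCHat J X)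
    (hY : IsCHat J Y) : IsCHat J (ModuleCat.of A (Y ⧸ LinearMap.range f.hom)) := by
  have := hY.isAdicComplete J
  obtain ⟨_, _, _⟩ := hX.exists_module_zhat
  obtain ⟨_, _, _⟩ := hY.exists_module_zhat
  let g := adicCompletionLinearMap (IsNoetherian.noetherian J) (f.hom.restrictScalars (Zc A))
  exact isCHat_of_linearEquiv J _ (N := Y ⧸ LinearMap.range g)
    ((Submodule.Quotient.restrictScalarsEquiv (Zc A) (LinearMap.range f.hom)).symm ≪≫ₗ
      Submodule.quotEquivOfEq _ _ rfl ≪≫ₗ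
      Submodule.Quotient.restrictScalarsEquiv (Zc A) (LinearMap.range g))

theorem isCHat_pi {ι : Type} [Finite ι] (X : ι → ModuleCat.{0} A) (hX : ∀ i, IsCHat J (X i)) :
    IsCHat J (ModuleCat.of A (∀ i, X i)) := by
  choose _ _ _ using fun i => (hX i).exists_module_zhat
  exact isCHat_of_finite_zhat J (ModuleCat.of A (∀ i, X i))

instance : (IsCHat J).IsClosedUnderKernels where
  kernels_le := by
    rintro _ ⟨f, k, hk, hf⟩
    exact (isCHat_ker J f hf.1 hf.2).of_iso J
      (Limits.IsLimit.conePointUniqueUpToIso (ModuleCat.kernelIsLimit f) hk)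

instance : (IsCHat J).IsClosedUnderCokernels where
  cokernels_le := by
    rintro _ ⟨f, k, hk, hf⟩
    exact (isCHat_quotient_range J f hf.1 hf.2).of_iso J
      (Limits.IsColimit.coconePointUniqueUpToIso (ModuleCat.cokernelIsColimit f) hk)

instance : (IsCHat J).ContainsZero where
  exists_zero := ⟨ModuleCat.of A PUnit, ModuleCat.isZero_of_subsingleton _,
    isCHat_of_linearEquiv J _ (LinearEquiv.refl (Zc A) PUnit)⟩

instance : (IsCHat J).IsClosedUnderFiniteProducts where
  isClosedUnderLimitsOfShape ι _ :=
    { limitsOfShape_le := by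
        rintro X ⟨p, hp⟩
        exact (isCHat_pi J _ fun i => hp ⟨i⟩).of_iso J
          (Limits.IsLimit.conePointsIsoOfNatIso p.isLimit
            (ModuleCat.productConeIsLimit fun i => p.diag.obj ⟨i⟩) Discrete.natIsoFunctor).symm }

end Abelian

section ProjectivePresentation

variable {C : Type*} [Category* C] [Preadditive C]

/-- `0 ⟶ K ⟶ P ⟶ M ⟶ 0` is a short exact sequence with projective middle term. -/
structure IsProjectivePresentation {K P M : C} (i : K ⟶ P) (p : P ⟶ M) : Prop where
  projective : Projective P
  shortExact : ∃ w, (ShortComplex.mk i p w).ShortExact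

end ProjectivePresentation

section DimensionShifting

universe w

theorem exists_addEquiv_of_exact {A₁ A₂ A₃ B₁ B₂ B₃ : Type*} [AddCommGroup A₁] [AddCommGroup A₂]
    [AddCommGroup A₃] [AddCommGroup B₁] [AddCommGroup B₂] [AddCommGroup B₃]
    {f : A₁ →+ A₂} {g : A₂ →+ A₃} {f' : B₁ →+ B₂} {g' : B₂ →+ B₃}
    (hfg : Function.Exact f g) (hfg' : Function.Exact f' g')
    (hg : Function.Surjective g) (hg' : Function.Surjective g')
    (e₁ : A₁ ≃+ B₁) (e₂ : A₂ ≃+ B₂) (h : ∀ a, e₂ (f a) = f' (e₁ a)) :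
    ∃ e₃ : A₃ ≃+ B₃, ∀ x, e₃ (g x) = g' (e₂ x) := by
  have map_ker : g.ker.map e₂.toAddMonoidHom = g'.ker := by
    ext y
    constructor
    · rintro ⟨x, hx, rfl⟩
      obtain ⟨a, rfl⟩ := (hfg x).1 hx
      exact (hfg' _).2 ⟨e₁ a, (h a).symm⟩
    · intro hy
      obtain ⟨b, rfl⟩ := (hfg' y).1 hy
      exact ⟨f (e₁.symm b), (hfg _).2 ⟨_, rfl⟩,
        (h _).trans (by rw [e₁.apply_symm_apply])⟩
  let q := QuotientAddGroup.quotientKerEquivOfSurjective g hg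
  let q' := QuotientAddGroup.quotientKerEquivOfSurjective g' hg'
  refine ⟨(q.symm.trans (QuotientAddGroup.congr _ _ e₂ map_ker)).trans q', fun x => ?_⟩
  have : q.symm (g x) = (x : A₂ ⧸ g.ker) := (AddEquiv.symm_apply_eq q).2 rfl
  simp only [AddEquiv.trans_apply, this]
  rfl

variable {C : Type*} [Category* C] [Abelian C] [HasExt.{w} C] {S : ShortComplex C}

theorem extClass_precomp_bijective (hS : S.ShortExact) [Projective S.X₂] (Y : C) (i : ℕ) :
    Function.Bijective (hS.extClass.precomp Y (by lia : 1 + (i + 1) = i + 2)) := by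
  constructor
  · rw [injective_iff_map_eq_zero]
    intro x hx
    obtain ⟨y, rfl⟩ := Ext.contravariant_sequence_exact₁ hS Y x (by lia : 1 + (i + 1) = i + 2) hx
    rw [Ext.eq_zero_of_projective y, Ext.comp_zero]
  · intro x
    exact Ext.contravariant_sequence_exact₃ hS Y x (Ext.eq_zero_of_projective _) (by lia)

theorem extClass_precomp_surjective (hS : S.ShortExact) [Projective S.X₂] (Y : C) :
    Function.Surjective (hS.extClass.precomp Y (add_zero 1)) := fun x =>
  Ext.contravariant_sequence_exact₃ hS Y x (Ext.eq_zero_of_projective _) (add_zero 1)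

theorem extClass_precomp_exact (hS : S.ShortExact) (Y : C) :
    Function.Exact ((Ext.mk₀ S.f).precomp Y (zero_add 0))
      (hS.extClass.precomp Y (add_zero 1)) := fun x =>
  ⟨fun hx => Ext.contravariant_sequence_exact₁ hS Y x (add_zero 1) hx,
    fun ⟨y, hy⟩ => hy ▸ hS.extClass_comp_assoc y (h := add_zero 1)⟩

end DimensionShifting

section ExtComparison

universe w w'

variable {k R : Type*} [CommRing k] [CommRing R] [Algebra k R] {B : Type*} [Category* B]
  {C : Type*} [Category* C] [Abelian C] [Linear k C] [HasExt.{w} C]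
  {D : Type*} [Category* D] [Abelian D] [HasExt.{w'} D]

variable (k R) in
/-- A natural identification of `Hom(F M, Y)` with the base change to `R` of `Hom(G M, N)`, where
`r : R` acts on `Hom(F M, Y)` by composition with an endomorphism `σ r` of `Y`. -/
structure HomComparison (G : B ⥤ C) (F : B ⥤ D) (N : C) (Y : D) (σ : R → (Y ⟶ Y)) where
  /-- The identification. -/
  equiv (M : B) : R ⊗[k] (G.obj M ⟶ N) ≃+ (F.obj M ⟶ Y)
  equiv_comp {M M' : B} (f : M ⟶ M') (r : R) (g : G.obj M' ⟶ N) :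
    equiv M (r ⊗ₜ (G.map f ≫ g)) = F.map f ≫ equiv M' (r ⊗ₜ g)
  equiv_smul (M : B) (r : R) (x : R ⊗[k] (G.obj M ⟶ N)) : equiv M (r • x) = equiv M x ≫ σ r

/-- Every object has a presentation which both functors send to a projective presentation. -/
def HaveCommonPresentations (G : B ⥤ C) (F : B ⥤ D) : Prop :=
  ∀ M : B, ∃ (K P : B) (i : K ⟶ P) (p : P ⟶ M),
    IsProjectivePresentation (G.map i) (G.map p) ∧ IsProjectivePresentation (F.map i) (F.map p)

namespace HomComparison

variable {G : B ⥤ C} {F : B ⥤ D} {N : C} {Y : D} {σ : R → (Y ⟶ Y)}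
  (c : HomComparison k R G F N Y σ)

/-- The comparison in degree zero. -/
noncomputable def extEquivZero (M : B) : R ⊗[k] Ext (G.obj M) N 0 ≃+ Ext (F.obj M) Y 0 :=
  ((LinearEquiv.baseChange k R _ _ (Ext.linearEquiv₀ (R := k))).toAddEquiv.trans
    (c.equiv M)).trans Ext.addEquiv₀.symm

theorem extEquivZero_tmul_mk₀ (M : B) (r : R) (g : G.obj M ⟶ N) :
    c.extEquivZero M (r ⊗ₜ Ext.mk₀ g) = Ext.mk₀ (c.equiv M (r ⊗ₜ g)) := by
  have : Ext.linearEquiv₀ (R := k) (Ext.mk₀ g) = g :=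
    (Ext.mk₀_bijective _ _).1 (Ext.mk₀_linearEquiv₀_apply _)
  change Ext.mk₀ (c.equiv M (r ⊗ₜ Ext.linearEquiv₀ (R := k) (Ext.mk₀ g))) = _
  rw [this]

theorem extEquivZero_smul (M : B) (r : R) (x : R ⊗[k] Ext (G.obj M) N 0) :
    c.extEquivZero M (r • x) = (c.extEquivZero M x).comp (Ext.mk₀ (σ r)) (add_zero 0) := by
  let e := LinearEquiv.baseChange k R _ _ (Ext.linearEquiv₀ (R := k) (X := G.obj M) (Y := N))
  change Ext.mk₀ (c.equiv M (e (r • x))) = (Ext.mk₀ (c.equiv M (e x))).comp _ _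
  rw [map_smul, c.equiv_smul, Ext.mk₀_comp_mk₀]

theorem extEquivZero_precomp {M M' : B} (f : M ⟶ M') (x : R ⊗[k] Ext (G.obj M') N 0) :
    c.extEquivZero M (((Ext.mk₀ (G.map f)).precompOfLinear k N (zero_add 0)).baseChange R x) =
      (Ext.mk₀ (F.map f)).precomp Y (zero_add 0) (c.extEquivZero M' x) := by
  induction x with
  | zero => simp only [map_zero]
  | add x y hx hy => simp only [map_add, hx, hy]
  | tmul r x =>
    obtain ⟨g, rfl⟩ := (Ext.mk₀_bijective _ _).2 x
    have : (Ext.mk₀ (G.map f)).precompOfLinear k N (zero_add 0) (Ext.mk₀ g) =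
        Ext.mk₀ (G.map f ≫ g) := Ext.mk₀_comp_mk₀ _ _
    rw [LinearMap.baseChange_tmul, this, extEquivZero_tmul_mk₀, extEquivZero_tmul_mk₀,
      c.equiv_comp]
    exact (Ext.mk₀_comp_mk₀ _ _).symm

theorem exists_extEquiv_one (c : HomComparison k R G F N Y σ) {K P M : B} {i : K ⟶ P} {p : P ⟶ M}
    (hG : IsProjectivePresentation (G.map i) (G.map p))
    (hF : IsProjectivePresentation (F.map i) (F.map p)) :
    ∃ e : R ⊗[k] Ext (G.obj M) N 1 ≃+ Ext (F.obj M) Y 1,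
      ∀ (r : R) x, e (r • x) = (e x).comp (Ext.mk₀ (σ r)) (add_zero 1) := by
  obtain ⟨hP, w, hS⟩ := hG
  obtain ⟨hFP, w', hS'⟩ := hF
  have : Projective (ShortComplex.mk (G.map i) (G.map p) w).X₂ := hP
  have : Projective (ShortComplex.mk (F.map i) (F.map p) w').X₂ := hFP
  let restrict := (Ext.mk₀ (G.map i)).precompOfLinear k N (zero_add 0)
  let connect := hS.extClass.precompOfLinear k N (add_zero 1)
  have connect_surjective : Function.Surjective (connect.baseChange R) :=
    LinearMap.lTensor_surjective R (extClass_precomp_surjective hS N)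
  have exact_connect : Function.Exact (restrict.baseChange R) (connect.baseChange R) :=
    lTensor_exact R (f := restrict) (g := connect) (extClass_precomp_exact hS N)
      (extClass_precomp_surjective hS N)
  obtain ⟨e, he⟩ := exists_addEquiv_of_exact
    (f := (restrict.baseChange R).toAddMonoidHom) (g := (connect.baseChange R).toAddMonoidHom)
    exact_connect (extClass_precomp_exact hS' Y) connect_surjective
    (extClass_precomp_surjective hS' Y) (c.extEquivZero P) (c.extEquivZero K)
    (c.extEquivZero_precomp i)
  change ∀ y, e (connect.baseChange R y) = _ at he
  refine ⟨e, fun r x => ?_⟩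
  obtain ⟨y, rfl⟩ := connect_surjective x
  rw [← map_smul, he, he, c.extEquivZero_smul]
  exact (Ext.comp_assoc _ _ _ (add_zero 1) (add_zero 0) (by lia)).symm

theorem exists_extEquiv_add_two {K P M : B} {i : K ⟶ P} {p : P ⟶ M}
    (hG : IsProjectivePresentation (G.map i) (G.map p))
    (hF : IsProjectivePresentation (F.map i) (F.map p)) {n : ℕ}
    (hK : ∃ e : R ⊗[k] Ext (G.obj K) N (n + 1) ≃+ Ext (F.obj K) Y (n + 1),
      ∀ (r : R) x, e (r • x) = (e x).comp (Ext.mk₀ (σ r)) (add_zero (n + 1))) :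
    ∃ e : R ⊗[k] Ext (G.obj M) N (n + 2) ≃+ Ext (F.obj M) Y (n + 2),
      ∀ (r : R) x, e (r • x) = (e x).comp (Ext.mk₀ (σ r)) (add_zero (n + 2)) := by
  obtain ⟨hP, w, hS⟩ := hG
  obtain ⟨hFP, w', hS'⟩ := hF
  obtain ⟨e, he⟩ := hK
  have : Projective (ShortComplex.mk (G.map i) (G.map p) w).X₂ := hP
  have : Projective (ShortComplex.mk (F.map i) (F.map p) w').X₂ := hFP
  let shift := LinearEquiv.baseChange k R _ _ (LinearEquiv.ofBijective
    (hS.extClass.precompOfLinear k N (by lia : 1 + (n + 1) = n + 2))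
    (extClass_precomp_bijective hS N n))
  let shift' := AddEquiv.ofBijective _ (extClass_precomp_bijective hS' Y n)
  refine ⟨(shift.symm.toAddEquiv.trans e).trans shift', fun r x => ?_⟩
  change shift' (e (shift.symm (r • x))) = (shift' (e (shift.symm x))).comp _ _
  rw [map_smul, he]
  exact (Ext.comp_assoc hS'.extClass (e (shift.symm x)) (Ext.mk₀ (σ r)) (by lia) (add_zero _)
    (by lia)).symm

theorem exists_extEquiv (c : HomComparison k R G F N Y σ) (h : HaveCommonPresentations G F)
    (n : ℕ) (M : B) :
    ∃ e : R ⊗[k] Ext (G.obj M) N n ≃+ Ext (F.obj M) Y n,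
      ∀ (r : R) x, e (r • x) = (e x).comp (Ext.mk₀ (σ r)) (add_zero n) := by
  induction n generalizing M with
  | zero => exact ⟨c.extEquivZero M, c.extEquivZero_smul M⟩
  | succ n ih =>
    obtain ⟨K, P, i, p, hG, hF⟩ := h M
    cases n with
    | zero => exact c.exists_extEquiv_one hG hF
    | succ n => exact exists_extEquiv_add_two hG hF (ih K)

end HomComparison

end ExtComparison

section LeftComp

variable {k C : Type*} [CommRing k] [Category* C] [Preadditive C] [Linear k C] (N : C)

theorem leftComp_injective {X Y : C} (f : X ⟶ Y) [Epi f] :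
    Function.Injective (Linear.leftComp k N f) := fun _ _ h => (cancel_epi f).1 h

theorem leftComp_exact [Balanced C] {S : ShortComplex C} (hS : S.Exact) [Epi S.g] :
    Function.Exact (Linear.leftComp k N S.g) (Linear.leftComp k N S.f) := fun h =>
  ⟨fun hh => ⟨hS.desc h hh, hS.g_desc h hh⟩, fun ⟨l, hl⟩ => by
    rw [← hl, Linear.leftComp_apply, Linear.leftComp_apply, ← Category.assoc, S.zero,
      Limits.zero_comp]⟩

end LeftComp

section FreePresentation

universe u

variable {A : Type u} [Ring A]

theorem exists_free_presentation [IsNoetherianRing A] (M : FGModuleCat.{u} A) :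
    ∃ (K P : FGModuleCat.{u} A) (i : K ⟶ P) (p : P ⟶ M), Module.Free A P ∧
      ∃ w, (ShortComplex.mk i.hom p.hom w).ShortExact := by
  obtain ⟨n, f, hf⟩ := Module.Finite.exists_fin' A M
  exact ⟨FGModuleCat.of A (LinearMap.ker f), FGModuleCat.of A (Fin n → A),
    FGModuleCat.ofHom (LinearMap.ker f).subtype, ObjectProperty.homMk (ModuleCat.ofHom f),
    inferInstanceAs (Module.Free A (Fin n → A)), _, LinearMap.shortExact_shortComplexKer hf⟩

theorem projective_of_free (P : ModuleCat.{u} A) [Module.Free A P] : Projective P :=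
  have := Module.Projective.of_free (R := A) (P := P)
  inferInstance

end FreePresentation

section HomCompletion

variable {A : Type} [Ring A] (J : Ideal (Zc A))

/-- The canonical map `Ẑ ⊗ Hom(M, N) → Hom(M, N̂)`. -/
noncomputable def homCompletion (M N : ModuleCat.{0} A) :
    ZHat J ⊗[Zc A] (M ⟶ N) →ₗ[Zc A] (M ⟶ completion J N) :=
  TensorProduct.lift (LinearMap.mk₂ (Zc A)
    (fun r g => (g ≫ completionOf J N) ≫ completionScalar J N r)
    (fun r s g => by
      ext m
      exact add_smul r s _)
    (fun z r g => by
      ext m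
      exact smul_assoc z r ((completionOf J N).hom (g.hom m)))
    (fun r g h => by rw [Preadditive.add_comp, Preadditive.add_comp])
    (fun z r g => by rw [Linear.smul_comp, Linear.smul_comp]))

theorem homCompletion_smul (M N : ModuleCat.{0} A) (r : ZHat J) (x : ZHat J ⊗[Zc A] (M ⟶ N)) :
    homCompletion J M N (r • x) = homCompletion J M N x ≫ completionScalar J N r := by
  induction x with
  | zero => rw [smul_zero, map_zero, Limits.zero_comp]
  | add x y hx hy => rw [smul_add, map_add, map_add, hx, hy, Preadditive.add_comp]
  | tmul s g =>
    ext m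
    exact mul_smul r s _

theorem homCompletion_leftComp {M M' : ModuleCat.{0} A} (f : M ⟶ M') (N : ModuleCat.{0} A)
    (x : ZHat J ⊗[Zc A] (M' ⟶ N)) :
    homCompletion J M N ((Linear.leftComp (Zc A) N f).lTensor (ZHat J) x) =
      f ≫ homCompletion J M' N x := by
  induction x with
  | zero => rw [map_zero, map_zero, map_zero, Limits.comp_zero]
  | add x y hx hy => rw [map_add, map_add, map_add, hx, hy, Preadditive.comp_add]
  | tmul s g => rfl

/-- Morphisms out of a free module, by their values on a basis. -/
noncomputable def homEquivPi {ι : Type*} {P : ModuleCat.{0} A} (b : Module.Basis ι A P)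
    (N : ModuleCat.{0} A) : (P ⟶ N) ≃ₗ[Zc A] (ι → N) :=
  ModuleCat.homLinearEquiv ≪≫ₗ (b.constr (Zc A)).symm

theorem homEquivPi_homCompletion {ι : Type} [Fintype ι] [DecidableEq ι] {P : ModuleCat.{0} A}
    (b : Module.Basis ι A P) (N : ModuleCat.{0} A) (x : ZHat J ⊗[Zc A] (P ⟶ N)) (j : ι) :
    homEquivPi b (completion J N) (homCompletion J P N x) j =
      (completionEquiv J N).symm (AdicCompletion.piEquivOfFintype J (fun _ : ι => N)
        (AdicCompletion.ofTensorProduct J (ι → N)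
          ((homEquivPi b N).lTensor (ZHat J) x)) j) := by
  induction x with
  | zero => simp only [map_zero, Pi.zero_apply]
  | add x y hx hy => simp only [map_add, Pi.add_apply, hx, hy]
  | tmul r g =>
    have proj_of : AdicCompletion.pi J (fun _ : ι => N)
        (AdicCompletion.of J (ι → N) (homEquivPi b N g)) j =
        AdicCompletion.of J N (homEquivPi b N g j) := AdicCompletion.map_of J _ _
    rw [LinearEquiv.lTensor_tmul, AdicCompletion.ofTensorProduct_tmul, map_smul,
      AdicCompletion.piEquivOfFintype_apply, Pi.smul_apply, proj_of]
    rfl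

variable [IsNoetherianRing (Zc A)] [Module.Finite (Zc A) A]

theorem homCompletion_bijective_of_free (P N : ModuleCat.{0} A) [Module.Finite A P]
    [Module.Free A P] [Module.Finite A N] : Function.Bijective (homCompletion J P N) := by
  classical
  have : Module.Finite (Zc A) N := Module.Finite.trans A N
  let b := Module.Free.chooseBasis A P
  have : Function.Bijective (homEquivPi b (completion J N) ∘ homCompletion J P N) := by
    convert (LinearEquiv.piCongrRight fun _ => (completionEquiv J N).symm).bijective.comp
      ((AdicCompletion.piEquivOfFintype J fun _ => (N : Type)).bijective.comp
        ((AdicCompletion.ofTensorProduct_bijective_of_finite_of_isNoetherian J _).comp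
          ((homEquivPi b N).lTensor (ZHat J)).bijective))
    funext x j
    exact homEquivPi_homCompletion J b N x j
  exact (Function.Bijective.of_comp_iff' (homEquivPi b (completion J N)).bijective _).1 this

theorem isNoetherianRing_of_finite_center : IsNoetherianRing A :=
  isNoetherian_of_tower (Zc A) inferInstance

theorem homCompletion_injective (M N : ModuleCat.{0} A) [Module.Finite A M]
    [Module.Finite A N] : Function.Injective (homCompletion J M N) := by
  have := isNoetherianRing_of_finite_center (A := A)
  obtain ⟨K, P, i, p, hP, w, hS⟩ := exists_free_presentation (FGModuleCat.of A M)
  have : Epi p.hom := hS.epi_g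
  have leftComp_p_injective : Function.Injective
      ((Linear.leftComp (Zc A) N p.hom).lTensor (ZHat J)) :=
    Module.Flat.lTensor_preserves_injective_linearMap _ (leftComp_injective N p.hom)
  rw [injective_iff_map_eq_zero]
  intro x hx
  apply leftComp_p_injective
  apply (homCompletion_bijective_of_free J P.obj N).1
  rw [homCompletion_leftComp, map_zero, map_zero]
  exact (congrArg (p.hom ≫ ·) hx).trans Limits.comp_zero

theorem homCompletion_bijective (M N : ModuleCat.{0} A) [Module.Finite A M]
    [Module.Finite A N] : Function.Bijective (homCompletion J M N) := by
  have := isNoetherianRing_of_finite_center (A := A)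
  refine ⟨homCompletion_injective J M N, fun h => ?_⟩
  obtain ⟨K, P, i, p, hP, w, hS⟩ := exists_free_presentation (FGModuleCat.of A M)
  have : Epi p.hom := hS.epi_g
  obtain ⟨y, hy⟩ := (homCompletion_bijective_of_free J P.obj N).2 (p.hom ≫ h)
  have restrict_y : (Linear.leftComp (Zc A) N i.hom).lTensor (ZHat J) y = 0 := by
    apply homCompletion_injective J K.obj N
    rw [homCompletion_leftComp, hy, map_zero, ← Category.assoc, w, Limits.zero_comp]
  have : Epi (ShortComplex.mk i.hom p.hom w).g := hS.epi_g
  obtain ⟨x, rfl⟩ := (Module.Flat.lTensor_exact (ZHat J) (leftComp_exact N hS.exact) y).1 restrict_y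
  refine ⟨x, (cancel_epi p.hom).1 ?_⟩
  rw [← hy]
  exact (homCompletion_leftComp J p.hom N x).symm

end HomCompletion

section CompletionHomEquiv

variable {A : Type} [Ring A] (J : Ideal (Zc A)) [IsNoetherianRing (Zc A)]
  {M M' E E' : ModuleCat.{0} A} [IsAdicComplete J E] [IsAdicComplete J E']

variable (M E) in
/-- Extension of morphisms to a complete module from a module to its completion. -/
noncomputable def completionHomEquiv : (M ⟶ E) ≃ₗ[Zc A] (completion J M ⟶ E) :=
  (LinearEquiv.ofBijective (Linear.leftComp (Zc A) E (completionOf J M))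
    ⟨fun _ _ h => completion_hom_ext J (IsNoetherian.noetherian J) h,
      exists_completionOf_comp_eq J⟩).symm

theorem completionOf_comp_completionHomEquiv (g : M ⟶ E) :
    completionOf J M ≫ completionHomEquiv J M E g = g :=
  (completionHomEquiv J M E).symm_apply_apply g

theorem completionMap_comp_completionHomEquiv (f : M ⟶ M') (g : M' ⟶ E) :
    completionMap J f ≫ completionHomEquiv J M' E g = completionHomEquiv J M E (f ≫ g) := by
  refine completion_hom_ext J (IsNoetherian.noetherian J) ?_
  rw [← Category.assoc, completionOf_comp_completionMap, Category.assoc,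
    completionOf_comp_completionHomEquiv, completionOf_comp_completionHomEquiv]

theorem completionHomEquiv_comp (g : M ⟶ E) (h : E ⟶ E') :
    completionHomEquiv J M E g ≫ h = completionHomEquiv J M E' (g ≫ h) := by
  refine completion_hom_ext J (IsNoetherian.noetherian J) ?_
  rw [← Category.assoc, completionOf_comp_completionHomEquiv,
    completionOf_comp_completionHomEquiv]

end CompletionHomEquiv

section ExtCompletion

variable {A : Type} [Ring A] (J : Ideal (Zc A)) [IsNoetherianRing (Zc A)] [Module.Finite (Zc A) A]

/-- The comparison `Ẑ ⊗ Hom(M, N) ≅ Hom(M, N̂)`. -/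
noncomputable def homComparisonCompletion (N : ModuleCat.{0} A) [Module.Finite A N] :
    HomComparison (Zc A) (ZHat J) (ModuleCat.isFG A).ι (ModuleCat.isFG A).ι N (completion J N)
      (completionScalar J N) where
  equiv M := AddEquiv.ofBijective (homCompletion J M.obj N)
    (have : Module.Finite A M.obj := M.property
     homCompletion_bijective J M.obj N)
  equiv_comp _ _ _ := rfl
  equiv_smul M r x := homCompletion_smul J M.obj N r x

theorem haveCommonPresentations_ι :
    HaveCommonPresentations (ModuleCat.isFG.{0} A).ι (ModuleCat.isFG.{0} A).ι := fun M => by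
  have := isNoetherianRing_of_finite_center (A := A)
  obtain ⟨K, P, i, p, hP, hS⟩ := exists_free_presentation (A := A) M
  have h : IsProjectivePresentation i.hom p.hom := ⟨projective_of_free P.obj, hS⟩
  exact ⟨K, P, i, p, h, h⟩

theorem exists_ext_completion_equiv (M N : ModuleCat.{0} A) [hM : Module.Finite A M]
    [Module.Finite A N] (i : ℕ) :
    ∃ e : ZHat J ⊗[Zc A] Ext M N i ≃+ Ext M (completion J N) i, ∀ (r : ZHat J) x,
      e (r • x) = (e x).comp (Ext.mk₀ (completionScalar J N r)) (add_zero i) :=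
  (homComparisonCompletion J N).exists_extEquiv haveCommonPresentations_ι i ⟨M, hM⟩

theorem shortExact_completionMap {K P M : ModuleCat.{0} A} [Module.Finite A P] {i : K ⟶ P}
    {p : P ⟶ M} (h : ∃ w, (ShortComplex.mk i p w).ShortExact) :
    ∃ w, (ShortComplex.mk (completionMap J i) (completionMap J p) w).ShortExact := by
  obtain ⟨w, hS⟩ := h
  have : Module.Finite (Zc A) P := Module.Finite.trans A P
  have exact_completion : Function.Exact (completionMap J i).hom (completionMap J p).hom :=
    AdicCompletion.map_exact (I := J) (f := i.hom.restrictScalars (Zc A))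
      (g := p.hom.restrictScalars (Zc A)) hS.moduleCat_injective_f
      ((ShortComplex.ShortExact.moduleCat_exact_iff_function_exact _).1 hS.exact)
      hS.moduleCat_surjective_g
  exact ⟨ModuleCat.hom_ext exact_completion.linearMap_comp_eq_zero,
    ModuleCat.shortComplex_shortExact _ exact_completion
    (AdicCompletion.map_injective J (f := i.hom.restrictScalars (Zc A)) hS.moduleCat_injective_f)
    (AdicCompletion.map_surjective J hS.moduleCat_surjective_g)⟩

variable [J.IsMaximal]

/-- Completion as a functor from finitely generated modules to `Ĉ(J)`. -/
noncomputable def completionFunctorCHat : FGModuleCat A ⥤ CHat J :=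
  (IsCHat J).lift ((ModuleCat.isFG A).ι ⋙ completionFunctor J) fun M =>
    have : Module.Finite A M.obj := M.property
    isCHat_completion J M.obj

theorem shortExact_chat {X Y Z : CHat J} (f : X ⟶ Y) (g : Y ⟶ Z)
    (h : ∃ w, (ShortComplex.mk f.hom g.hom w).ShortExact) :
    ∃ w, (ShortComplex.mk f g w).ShortExact := by
  obtain ⟨w, hS⟩ := h
  have comp_eq_zero : f ≫ g = 0 := ObjectProperty.hom_ext _ w
  have : Mono f := (IsCHat J).ι.mono_of_mono_map (f := f) hS.mono_f
  have : Epi g := (IsCHat J).ι.epi_of_epi_map (f := g) hS.epi_g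
  refine ⟨comp_eq_zero, { exact := ShortComplex.exact_of_f_is_kernel _ ?_ }⟩
  exact Limits.isLimitOfReflects (IsCHat J).ι
    ((Limits.KernelFork.isLimitMapConeEquiv _ _).symm hS.fIsKernel)

theorem epi_hom_of_epi_chat {X Y : CHat J} (f : X ⟶ Y) [Epi f] : Epi f.hom := by
  have := (IsCHat J).preservesEpimorphisms_ι_of_isNormalMonoCategory
  exact inferInstanceAs (Epi ((IsCHat J).ι.map f))

theorem projective_completion (P : ModuleCat.{0} A) [Projective P]
    (h : IsCHat J (completion J P)) : Projective (completionObj J P h) where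
  factors {E X} f e he := by
    have := E.property.isAdicComplete J
    have := X.property.isAdicComplete J
    have := epi_hom_of_epi_chat J e
    let g : P ⟶ E.obj := Projective.factorThru (completionOf J P ≫ f.hom) e.hom
    refine ⟨ObjectProperty.homMk (completionHomEquiv J P E.obj g), ObjectProperty.hom_ext _ ?_⟩
    change completionHomEquiv J P E.obj g ≫ e.hom = f.hom
    rw [completionHomEquiv_comp, Projective.factorThru_comp]
    exact (completionHomEquiv J P X.obj).apply_symm_apply f.hom

theorem haveCommonPresentations_completionFunctorCHat :
    HaveCommonPresentations (ModuleCat.isFG A).ι (completionFunctorCHat J) := fun M => by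
  have := isNoetherianRing_of_finite_center (A := A)
  obtain ⟨K, P, i, p, hP, hS⟩ := exists_free_presentation (A := A) M
  have projective_P : Projective P.obj := projective_of_free P.obj
  have : Module.Finite A P.obj := P.property
  exact ⟨K, P, i, p, ⟨projective_P, hS⟩, projective_completion J P.obj _,
    shortExact_chat J _ _ (shortExact_completionMap J (P := P.obj) hS)⟩

/-- Morphisms in `Ĉ(J)` are morphisms of the underlying modules. -/
def homEquivCHat (X Y : CHat J) : (X.obj ⟶ Y.obj) ≃+ (X ⟶ Y) :=
  { (IsCHat J).fullyFaithfulι.homEquiv.symm with map_add' := fun _ _ => rfl }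

/-- The comparison `Ẑ ⊗ Hom(M, N) ≅ Hom(M̂, N̂)`. -/
noncomputable def homComparisonCHat (N : ModuleCat.{0} A) [Module.Finite A N]
    (h : IsCHat J (completion J N)) :
    HomComparison (Zc A) (ZHat J) (ModuleCat.isFG A).ι (completionFunctorCHat J) N
      (completionObj J N h) (completionObjScalar J N h) :=
  have : IsAdicComplete J (completion J N) := h.isAdicComplete J
  let c := homComparisonCompletion J N
  { equiv M := ((c.equiv M).trans (completionHomEquiv J M.obj (completion J N)).toAddEquiv).trans
      (homEquivCHat J ((completionFunctorCHat J).obj M) (completionObj J N h))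
    equiv_comp f r g := ObjectProperty.hom_ext _
      (completionMap_comp_completionHomEquiv J f.hom (c.equiv _ (r ⊗ₜ g))).symm
    equiv_smul M r x := ObjectProperty.hom_ext _ <|
      (congrArg (completionHomEquiv J M.obj (completion J N)) (c.equiv_smul M r x)).trans
        (completionHomEquiv_comp J (c.equiv M x) (completionScalar J N r)).symm }

theorem exists_ext_chat_equiv [HasExt.{1} (CHat J)] (M N : ModuleCat.{0} A)
    [hM : Module.Finite A M] [Module.Finite A N] (h₁ : IsCHat J (completion J M))
    (h₂ : IsCHat J (completion J N)) (i : ℕ) :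
    ∃ e : ZHat J ⊗[Zc A] Ext M N i ≃+ Ext (completionObj J M h₁) (completionObj J N h₂) i,
      ∀ (r : ZHat J) x,
        e (r • x) = (e x).comp (Ext.mk₀ (completionObjScalar J N h₂ r)) (add_zero i) :=
  (homComparisonCHat J N h₂).exists_extEquiv (haveCommonPresentations_completionFunctorCHat J) i
    ⟨M, hM⟩

end ExtCompletion

section BaseChangeOfTorsion

variable {R E : Type*} [CommRing R] {I : Ideal R} [AddCommGroup E] [Module R E] {m : ℕ}

theorem tmul_one_injective_of_pow_smul_eq_zero (h : ∀ z ∈ I ^ m, ∀ x : E, z • x = 0) :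
    Function.Injective (TensorProduct.mk R (AdicCompletion I R) E 1) := by
  let act : (R ⧸ I ^ m) →ₗ[R] E →ₗ[R] E :=
    Submodule.liftQ (I ^ m) (LinearMap.lsmul R E) fun z hz => LinearMap.ext (h z hz)
  let retract := TensorProduct.lift (act ∘ₗ (AdicCompletion.evalₐ I m).toLinearMap)
  have retract_one_tmul : Function.LeftInverse retract
      (TensorProduct.mk R (AdicCompletion I R) E 1) := fun x => by
    change act (AdicCompletion.evalₐ I m 1) x = x
    rw [map_one]
    exact one_smul R x
  exact retract_one_tmul.injective

theorem tmul_eq_zero_of_mem_pow_smul_top (h : ∀ z ∈ I ^ m, ∀ x : E, z • x = 0) {S : Type*}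
    [AddCommGroup S] [Module R S] {s : S} (hs : s ∈ (I ^ m • ⊤ : Submodule R S)) (x : E) :
    s ⊗ₜ[R] x = 0 := by
  refine Submodule.smul_induction_on hs (fun z hz t _ => ?_) fun s t hs ht => ?_
  · rw [TensorProduct.smul_tmul, h z hz, TensorProduct.tmul_zero]
  · rw [TensorProduct.add_tmul, hs, ht, add_zero]

theorem tmul_one_surjective_of_pow_smul_eq_zero (hI : I.FG)
    (h : ∀ z ∈ I ^ m, ∀ x : E, z • x = 0) :
    Function.Surjective (TensorProduct.mk R (AdicCompletion I R) E 1) := by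
  rw [← LinearMap.range_eq_top, eq_top_iff, ← TensorProduct.span_tmul_eq_top,
    Submodule.span_le]
  rintro _ ⟨r, x, rfl⟩
  obtain ⟨z, hz⟩ := exists_sub_of_mem_pow_smul_top hI r m
  have tmul_eq := tmul_eq_zero_of_mem_pow_smul_top h hz x
  rw [TensorProduct.sub_tmul, sub_eq_zero] at tmul_eq
  have of_eq_smul_one : AdicCompletion.of I R z = z • (1 : AdicCompletion I R) :=
    Algebra.algebraMap_eq_smul_one z
  refine ⟨z • x, ?_⟩
  rw [tmul_eq, of_eq_smul_one, TensorProduct.smul_tmul, TensorProduct.mk_apply]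

end BaseChangeOfTorsion

section Torsion

variable {A : Type} [Ring A] (J : Ideal (Zc A))

theorem centralSMul_pow_antitone (M : Type*) [AddCommGroup M] [Module A M] :
    Antitone fun n => centralSMul (J ^ n) M := fun _ _ hmn =>
  Submodule.smul_mono_left (N := (⊤ : Submodule (Zc A) M)) (Ideal.pow_le_pow_right hmn)

theorem exists_pow_smul_eq_zero {M : ModuleCat.{0} A} [IsHausdorff J M]
    (h : IsFiniteLength A M) : ∃ m : ℕ, ∀ z ∈ J ^ m, ∀ x : M, z • x = 0 := by
  have := (isFiniteLength_iff_isNoetherian_isArtinian.1 h).2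
  have antitone := centralSMul_pow_antitone J M
  obtain ⟨m, hm⟩ := IsArtinian.monotone_stabilizes ⟨_, antitone.dual_right⟩
  have le_centralSMul (n : ℕ) : centralSMul (J ^ m) M ≤ centralSMul (J ^ n) M := by
    rcases le_total m n with hmn | hmn
    · exact (OrderDual.toDual.injective (hm n hmn)).le
    · exact antitone hmn
  refine ⟨m, fun z hz x => ?_⟩
  have smul_mem : z • x ∈ (J ^ m • ⊤ : Submodule (Zc A) M) := Submodule.smul_mem_smul hz trivial
  exact IsHausdorff.haus (I := J) inferInstance _ fun n =>
    SModEq.zero.2 (le_centralSMul n smul_mem)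

end Torsion

section ExtTorsion

variable {k C : Type*} [CommRing k] [Category* C] [Abelian C] [Linear k C] [HasExt C] {M N : C}
  {z : k} {i : ℕ}

theorem smul_ext_eq_zero_of_left (h : z • 𝟙 M = 0) (x : Ext M N i) : z • x = 0 := by
  rw [← Ext.mk₀_id_comp x, ← Ext.smul_comp, ← Ext.mk₀_smul, h, Ext.mk₀_zero, Ext.zero_comp]

theorem smul_ext_eq_zero_of_right (h : z • 𝟙 N = 0) (x : Ext M N i) : z • x = 0 := by
  rw [Ext.smul_eq_comp_mk₀, h, Ext.mk₀_zero, Ext.comp_zero]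

end ExtTorsion

section ExtFiniteLength

variable {A : Type} [Ring A] (J : Ideal (Zc A)) [IsNoetherianRing (Zc A)] [Module.Finite (Zc A) A]

theorem IsCHat.exists_pow_smul_id_eq_zero {M : ModuleCat.{0} A} (h : IsCHat J M)
    (hM : IsFiniteLength A M) : ∃ m : ℕ, ∀ z ∈ J ^ m, z • 𝟙 M = 0 := by
  have := h.isAdicComplete J
  obtain ⟨m, hm⟩ := exists_pow_smul_eq_zero J hM
  exact ⟨m, fun z hz => ModuleCat.hom_ext (LinearMap.ext (hm z hz))⟩

variable [J.IsMaximal]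

theorem exists_ext_chat_equiv_of_isFiniteLength [HasExt.{1} (CHat J)] (M N : ModuleCat.{0} A)
    [Module.Finite A M] [Module.Finite A N] (h₁ : IsCHat J (completion J M))
    (h₂ : IsCHat J (completion J N)) (i : ℕ)
    (h : (IsFiniteLength A M ∧ IsCHat J M) ∨ (IsFiniteLength A N ∧ IsCHat J N)) :
    ∃ e : Ext M N i ≃+ Ext (completionObj J M h₁) (completionObj J N h₂) i,
      ∀ (z : Zc A) x, e (z • x) = (e x).comp
        (Ext.mk₀ (completionObjScalar J N h₂ (algebraMap _ (ZHat J) z))) (add_zero i) := by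
  obtain ⟨m, hm⟩ : ∃ m : ℕ, ∀ z ∈ J ^ m, ∀ x : Ext M N i, z • x = 0 := by
    rcases h with ⟨hM, hMJ⟩ | ⟨hN, hNJ⟩
    · obtain ⟨m, hm⟩ := hMJ.exists_pow_smul_id_eq_zero J hM
      exact ⟨m, fun z hz => smul_ext_eq_zero_of_left (hm z hz)⟩
    · obtain ⟨m, hm⟩ := hNJ.exists_pow_smul_id_eq_zero J hN
      exact ⟨m, fun z hz => smul_ext_eq_zero_of_right (hm z hz)⟩
  let unit := LinearEquiv.ofBijective (TensorProduct.mk (Zc A) (ZHat J) (Ext M N i) 1)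
    ⟨tmul_one_injective_of_pow_smul_eq_zero hm,
      tmul_one_surjective_of_pow_smul_eq_zero (IsNoetherian.noetherian J) hm⟩
  obtain ⟨e, he⟩ := exists_ext_chat_equiv J M N h₁ h₂ i
  refine ⟨unit.toAddEquiv.trans e, fun z x => ?_⟩
  change e (unit (z • x)) = (e (unit x)).comp _ _
  rw [map_smul, ← algebraMap_smul (ZHat J) z (unit x), he]

end ExtFiniteLength

section FiniteOverCentral

/-- The algebra `A` is a finite module over a finitely generated central subalgebra `S`. This
implies finiteness over the whole centre and, unlike it, passes to tensor products. -/
def IsFiniteOverCentral (k A : Type*) [CommRing k] [Ring A] [Algebra k A] : Prop :=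
  ∃ S : Subalgebra k A, S.FG ∧ S ≤ Subalgebra.center k A ∧ Module.Finite S A

namespace IsFiniteOverCentral

theorem module_finite {k A : Type} [CommRing k] [Ring A] [Algebra k A]
    (h : IsFiniteOverCentral k A) : Module.Finite (Zc A) A := by
  obtain ⟨S, -, hcenter, hfinite⟩ := h
  let toCenter : S →+* Zc A := S.val.toRingHom.codRestrict (Zc A) fun s => hcenter s.2
  let _ : Module S (Zc A) := Module.compHom _ toCenter
  have : IsScalarTower S (Zc A) A := ⟨fun s z a => mul_assoc (s : A) z a⟩
  exact Module.Finite.of_restrictScalars_finite S (Zc A) A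

open scoped IsMulCommutative in
theorem isNoetherianRing {k A : Type} [CommRing k] [IsNoetherianRing k] [Ring A] [Algebra k A]
    (h : IsFiniteOverCentral k A) : IsNoetherianRing (Zc A) := by
  obtain ⟨S, hS, hcenter, hfinite⟩ := h
  have : IsMulCommutative S :=
    ⟨⟨fun x y => Subtype.ext (Subalgebra.mem_center_iff.1 (hcenter y.2) x)⟩⟩
  have : Algebra.FiniteType k S := S.fg_iff_finiteType.1 hS
  have : IsNoetherianRing S := Algebra.FiniteType.isNoetherianRing k S
  let toCenter : S →+* Zc A := S.val.toRingHom.codRestrict (Zc A) fun s => hcenter s.2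
  let _ : Module S (Zc A) := Module.compHom _ toCenter
  have : IsScalarTower S (Zc A) (Zc A) := ⟨fun s z z' => Subtype.ext (mul_assoc (s : A) z z')⟩
  let incl : Zc A →ₗ[S] A :=
    { toFun := fun z => z
      map_add' := fun _ _ => rfl
      map_smul' := fun _ _ => rfl }
  exact isNoetherian_of_tower S (isNoetherian_of_injective incl Subtype.val_injective)

end IsFiniteOverCentral

section PiTensorProduct

variable {k ι : Type*} [CommRing k] {A : ι → Type*} [∀ i, Ring (A i)] [∀ i, Algebra k (A i)]

theorem tprod_mem_of_singleAlgHom_mem [Finite ι] [DecidableEq ι] (S : Subalgebra k (⨂[k] i, A i))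
    {c : ∀ i, A i} (h : ∀ i, PiTensorProduct.singleAlgHom (R := k) i (c i) ∈ S) :
    PiTensorProduct.tprod k c ∈ S := by
  have := Fintype.ofFinite ι
  have hprod := PiTensorProduct.tprod_noncommProd (R := k) Finset.univ
    (fun i => Pi.mulSingle i (c i)) fun i _ j _ _ => Pi.mulSingle_apply_commute c i j
  rw [Finset.noncommProd_mulSingle] at hprod
  exact hprod ▸ Submonoid.noncommProd_mem S.toSubmonoid _ _ _ fun i _ => h i

theorem singleAlgHom_mem_center [DecidableEq ι] {i : ι} {c : A i}
    (hc : c ∈ Subalgebra.center k (A i)) :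
    PiTensorProduct.singleAlgHom (R := k) i c ∈ Subalgebra.center k (⨂[k] i, A i) := by
  rw [Subalgebra.mem_center_iff]
  intro a
  induction a using PiTensorProduct.induction_on with
  | smul_tprod r x =>
    have hcomm : Commute x (Pi.mulSingle i c) := by
      ext j
      obtain rfl | hij := eq_or_ne j i
      · simpa using Subalgebra.mem_center_iff.1 hc (x j)
      · simp [hij]
    exact (Commute.tprod hcomm).smul_left r
  | add a b ha hb => rw [add_mul, mul_add, ha, hb]

theorem finite_piTensorProduct_of_tprod_mem [Finite ι] {S : ∀ i, Subalgebra k (A i)}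
    [∀ i, Module.Finite (S i) (A i)] {S' : Subalgebra k (⨂[k] i, A i)}
    (hS' : ∀ c : ∀ i, A i, (∀ i, c i ∈ S i) → PiTensorProduct.tprod k c ∈ S') :
    Module.Finite S' (⨂[k] i, A i) := by
  classical
  have := Fintype.ofFinite ι
  choose m g hg using fun i => Module.Finite.exists_fin (R := S i) (M := A i)
  let generator (r : ∀ i, Fin (m i)) : ⨂[k] i, A i := PiTensorProduct.tprod k fun i => g i (r i)
  refine ⟨Submodule.fg_def.2 ⟨Set.range generator, Set.finite_range _, eq_top_iff.2 ?_⟩⟩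
  rintro a -
  induction a using PiTensorProduct.induction_on with
  | smul_tprod r x =>
    rw [← algebraMap_smul S' r]
    refine Submodule.smul_mem _ _ ?_
    have hspan (i : ι) : x i ∈ Submodule.span (S i) (Set.range (g i)) := hg i ▸ Submodule.mem_top
    choose c hc using fun i => (Submodule.mem_span_range_iff_exists_fun (S i)).1 (hspan i)
    have hx : x = fun i => ∑ j, (c i j : A i) * g i j := funext fun i => (hc i).symm
    rw [hx, MultilinearMap.map_sum]
    refine sum_mem fun r _ => ?_
    have hcS' := hS' (fun i => c i (r i)) fun i => (c i (r i)).2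
    have hfactor := PiTensorProduct.tprod_mul_tprod (R := k)
      (fun i => (c i (r i) : A i)) fun i => g i (r i)
    exact hfactor ▸ Submodule.smul_mem _ (⟨_, hcS'⟩ : S') (Submodule.subset_span ⟨r, rfl⟩)
  | add a b ha hb => exact add_mem ha hb

theorem fg_iSup_subalgebra {B : Type*} [Ring B] [Algebra k B] [Finite ι] {S : ι → Subalgebra k B}
    (h : ∀ i, (S i).FG) : (⨆ i, S i).FG := by
  choose s hs using fun i => Subalgebra.fg_def.1 (h i)
  refine Subalgebra.fg_def.2 ⟨⋃ i, s i, Set.finite_iUnion fun i => (hs i).1, ?_⟩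
  rw [Algebra.adjoin_iUnion, iSup_congr fun i => (hs i).2]

theorem IsFiniteOverCentral.piTensorProduct [Finite ι] (h : ∀ i, IsFiniteOverCentral k (A i)) :
    IsFiniteOverCentral k (⨂[k] i, A i) := by
  classical
  choose S hS hcenter hfinite using h
  refine ⟨⨆ i, (S i).map (PiTensorProduct.singleAlgHom i),
    fg_iSup_subalgebra fun i => (hS i).map _, iSup_le fun i => ?_,
    finite_piTensorProduct_of_tprod_mem fun c hc => tprod_mem_of_singleAlgHom_mem _ fun i =>
      le_iSup (fun i => (S i).map (PiTensorProduct.singleAlgHom i)) i ⟨c i, hc i, rfl⟩⟩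
  rintro _ ⟨c, hc, rfl⟩
  exact singleAlgHom_mem_center (hcenter i hc)

end PiTensorProduct

end FiniteOverCentral

section FiniteHecke

open Subalgebra (toSubmodule)
open Submodule (span)

variable {k H : Type*} [CommRing k] [Ring H] [Algebra k H]

theorem adjoin_le_of_mul_mem {s : Set H} {W : Submodule k H} (hone : 1 ∈ W)
    (hmul : ∀ x ∈ s, ∀ w ∈ W, w * x ∈ W) : toSubmodule (Algebra.adjoin k s) ≤ W := by
  intro x hx
  suffices ∀ w ∈ W, w * x ∈ W by simpa using this 1 hone
  induction hx using Algebra.adjoin_induction with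
  | mem x hx => exact hmul x hx
  | algebraMap r =>
    intro w hw
    rw [← Algebra.commutes, ← Algebra.smul_def]
    exact W.smul_mem r hw
  | add x y _ _ hx hy => exact fun w hw => mul_add w x y ▸ add_mem (hx w hw) (hy w hw)
  | mul x y _ _ hx hy => exact fun w hw => mul_assoc w x y ▸ hy _ (hx w hw)

/-- The submodule `P + P t P`. In a Hecke algebra, where `P` is generated by the first `m` simple
reflections and `t` is the next one, this is the whole subalgebra generated by `P` and `t`. -/
def doubleCosetSpan (P : Subalgebra k H) (t : H) : Submodule k H :=
  toSubmodule P ⊔ toSubmodule P * span k {t} * toSubmodule P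

section DoubleCosetSpan

variable {P Q : Subalgebra k H} {s : Set H} {t u : H}

theorem le_doubleCosetSpan : toSubmodule P ≤ doubleCosetSpan P t := le_sup_left

theorem mul_mul_mem_doubleCosetSpan {a b : H} (ha : a ∈ P) (hb : b ∈ P) :
    a * t * b ∈ doubleCosetSpan P t :=
  Submodule.mem_sup_right <| Submodule.mul_mem_mul
    (Submodule.mul_mem_mul ha (Submodule.mem_span_singleton_self t)) hb

theorem doubleCosetSpan_le {W : Submodule k H} (hP : toSubmodule P ≤ W)
    (hmul : ∀ a ∈ P, ∀ b ∈ P, a * t * b ∈ W) : doubleCosetSpan P t ≤ W := by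
  refine sup_le hP <| Submodule.mul_le.2 fun x hx b hb => ?_
  obtain ⟨a, ha, rfl⟩ := Submodule.mem_mul_span_singleton.1 hx
  exact hmul a ha b hb

theorem mul_mem_doubleCosetSpan {a x : H} (ha : a ∈ P) (hx : x ∈ doubleCosetSpan P t) :
    a * x ∈ doubleCosetSpan P t := by
  refine doubleCosetSpan_le (W := (doubleCosetSpan P t).comap (LinearMap.mulLeft k a))
    (fun b hb => le_doubleCosetSpan (P.mul_mem ha hb)) (fun b hb c hc => ?_) hx
  simpa [mul_assoc] using mul_mul_mem_doubleCosetSpan (t := t) (mul_mem ha hb) hc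

theorem doubleCosetSpan_fg (hP : (toSubmodule P).FG) : (doubleCosetSpan P t).FG :=
  hP.sup ((hP.mul (Submodule.fg_span_singleton t)).mul hP)

theorem adjoin_insert_eq_doubleCosetSpan
    (h : ∀ x ∈ Algebra.adjoin k s, t * x * t ∈ doubleCosetSpan (Algebra.adjoin k s) t) :
    toSubmodule (Algebra.adjoin k (insert t s)) = doubleCosetSpan (Algebra.adjoin k s) t := by
  set P := Algebra.adjoin k s
  have hP : P ≤ Algebra.adjoin k (insert t s) := Algebra.adjoin_mono (Set.subset_insert t s)
  have ht : t ∈ Algebra.adjoin k (insert t s) := Algebra.subset_adjoin (Set.mem_insert t s)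
  refine le_antisymm (adjoin_le_of_mul_mem (le_doubleCosetSpan (one_mem P)) ?_)
    (doubleCosetSpan_le hP fun a ha b hb =>
      Subalgebra.mul_mem _ (Subalgebra.mul_mem _ (hP ha) ht) (hP hb))
  rintro x (rfl | hx) w hw
  · refine doubleCosetSpan_le (W := (doubleCosetSpan P x).comap (LinearMap.mulRight k x))
      (fun a ha => ?_) (fun a ha b hb => ?_) hw
    · simpa using mul_mul_mem_doubleCosetSpan (t := x) ha (one_mem P)
    · simpa [mul_assoc] using mul_mem_doubleCosetSpan ha (h b hb)
  · have hxP : x ∈ P := Algebra.subset_adjoin hx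
    refine doubleCosetSpan_le (W := (doubleCosetSpan P t).comap (LinearMap.mulRight k x))
      (fun a ha => le_doubleCosetSpan (P.mul_mem ha hxP)) (fun a ha b hb => ?_) hw
    simpa [mul_assoc] using mul_mul_mem_doubleCosetSpan (t := t) ha (mul_mem hb hxP)

variable {q : k}

theorem mul_mul_self_mem_doubleCosetSpan_of_commute (hsq : u * u = (q - 1) • u + q • 1) {x : H}
    (hx : x ∈ P) (hcomm : Commute u x) : u * x * u ∈ doubleCosetSpan P u := by
  have hxu : x * u ∈ doubleCosetSpan P u := by
    simpa using mul_mul_mem_doubleCosetSpan (t := u) hx (one_mem P)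
  rw [hcomm.eq, mul_assoc, hsq, mul_add, mul_smul_comm, mul_smul_comm, mul_one]
  exact add_mem (Submodule.smul_mem _ _ hxu) (Submodule.smul_mem _ _ (le_doubleCosetSpan hx))

theorem mul_mul_self_mem_doubleCosetSpan_of_braid (hsq : u * u = (q - 1) • u + q • 1)
    (hbraid : t * u * t = u * t * u) (hcomm : ∀ a ∈ P, Commute u a) (hPQ : P ≤ Q) (ht : t ∈ Q)
    {x : H} (hx : x ∈ doubleCosetSpan P t) : u * x * u ∈ doubleCosetSpan Q u := by
  refine doubleCosetSpan_le (W := (doubleCosetSpan Q u).comap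
      ((LinearMap.mulRight k u).comp (LinearMap.mulLeft k u)))
    (fun a ha => mul_mul_self_mem_doubleCosetSpan_of_commute hsq (hPQ ha) (hcomm a ha))
    (fun a ha b hb => ?_) hx
  have hfactor : u * (a * t * b) * u = a * t * u * (t * b) :=
    calc u * (a * t * b) * u = u * a * t * (b * u) := by noncomm_ring
      _ = a * (u * t * u) * b := by rw [hcomm a ha, ← hcomm b hb]; noncomm_ring
      _ = a * t * u * (t * b) := by rw [← hbraid]; noncomm_ring
  change u * (a * t * b) * u ∈ doubleCosetSpan Q u
  exact hfactor ▸ mul_mul_mem_doubleCosetSpan (mul_mem (hPQ ha) ht) (mul_mem ht (hPQ hb))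

end DoubleCosetSpan

theorem adjoin_image_Iio_zero (T : ℕ → H) : Algebra.adjoin k (T '' Set.Iio 0) = ⊥ := by simp

/-- The elements `T 0, …, T (N - 1)` satisfy the relations of the Hecke algebra of the symmetric
group on `N + 1` letters with parameter `q`. -/
structure IsHeckeFamily (N : ℕ) (q : k) (T : ℕ → H) : Prop where
  mul_self : ∀ i < N, T i * T i = (q - 1) • T i + q • 1
  braid : ∀ i, i + 1 < N → T i * T (i + 1) * T i = T (i + 1) * T i * T (i + 1)
  commute : ∀ i j, i + 1 < j → j < N → Commute (T i) (T j)

namespace IsHeckeFamily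

variable {N : ℕ} {q : k} {T : ℕ → H}

theorem commute_adjoin (hT : IsHeckeFamily N q T) {m j : ℕ} (hmj : m < j) (hj : j < N) {x : H}
    (hx : x ∈ Algebra.adjoin k (T '' Set.Iio m)) : Commute (T j) x := by
  have hle : Algebra.adjoin k (T '' Set.Iio m) ≤ Subalgebra.centralizer k {T j} := by
    refine Algebra.adjoin_le ?_
    rintro _ ⟨i, hi : i < m, rfl⟩
    exact (Subalgebra.mem_centralizer_iff k).2 fun _ h => h ▸ (hT.commute i j (by lia) hj).symm.eq
  exact (Subalgebra.mem_centralizer_iff k).1 (hle hx) _ rfl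

theorem mul_mul_self_mem_doubleCosetSpan (hT : IsHeckeFamily N q T) {m : ℕ} (hm : m < N) {x : H}
    (hx : x ∈ Algebra.adjoin k (T '' Set.Iio m)) :
    T m * x * T m ∈ doubleCosetSpan (Algebra.adjoin k (T '' Set.Iio m)) (T m) := by
  induction m generalizing x with
  | zero =>
    have hcomm : Commute (T 0) x := by
      rw [adjoin_image_Iio_zero] at hx
      obtain ⟨r, rfl⟩ := Algebra.mem_bot.1 hx
      exact (Algebra.commutes r _).symm
    exact mul_mul_self_mem_doubleCosetSpan_of_commute (hT.mul_self 0 hm) hx hcomm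
  | succ m ih =>
    rw [Set.Iio_add_one_eq_Iic, ← Set.Iio_insert, Set.image_insert_eq] at hx
    refine mul_mul_self_mem_doubleCosetSpan_of_braid (hT.mul_self _ hm) (hT.braid m hm)
      (fun a => hT.commute_adjoin m.lt_succ_self hm)
      (Algebra.adjoin_mono (Set.image_mono (Set.Iio_subset_Iio m.le_succ)))
      (Algebra.subset_adjoin ⟨m, m.lt_succ_self, rfl⟩)
      ((adjoin_insert_eq_doubleCosetSpan fun y => ih (by lia)).le hx)

theorem adjoin_fg (hT : IsHeckeFamily N q T) {m : ℕ} (hm : m ≤ N) :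
    (toSubmodule (Algebra.adjoin k (T '' Set.Iio m))).FG := by
  induction m with
  | zero =>
    rw [adjoin_image_Iio_zero, Algebra.toSubmodule_bot, Submodule.one_eq_span]
    exact Submodule.fg_span_singleton 1
  | succ m ih =>
    rw [Set.Iio_add_one_eq_Iic, ← Set.Iio_insert, Set.image_insert_eq,
      adjoin_insert_eq_doubleCosetSpan fun x => hT.mul_mul_self_mem_doubleCosetSpan hm]
    exact doubleCosetSpan_fg (ih (by lia))

end IsHeckeFamily

end FiniteHecke

section Integrality

open Polynomial

variable {k B : Type*} [CommRing k] [CommRing B] [Algebra k B] {ι : Type*} [Fintype ι]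

theorem coeff_prod_X_sub_C_mem (Q : Subring B) (Y : ι → B) {a b : ι} (hab : a ≠ b)
    (hadd : Y a + Y b ∈ Q) (hmul : Y a * Y b ∈ Q) (hother : ∀ j, j ≠ a → j ≠ b → Y j ∈ Q) (i : ℕ) :
    (∏ j, (X - C (Y j))).coeff i ∈ Q := by
  classical
  have hX : (X : B[X]) ∈ liftsRing Q.subtype := (lifts_iff_liftsRing _ _).1 (X_mem_lifts _)
  have hC {x : B} (hx : x ∈ Q) : C x ∈ liftsRing Q.subtype :=
    (lifts_iff_liftsRing _ _).1 (C'_mem_lifts ⟨⟨x, hx⟩, rfl⟩)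
  have hlift : ∏ j, (X - C (Y j)) ∈ liftsRing Q.subtype := by
    rw [← Finset.mul_prod_erase _ _ (Finset.mem_univ a),
      ← Finset.mul_prod_erase _ _ (Finset.mem_erase.2 ⟨hab.symm, Finset.mem_univ b⟩), ← mul_assoc]
    refine mul_mem ?_ (prod_mem fun j hj => ?_)
    · have hquad : (X - C (Y a)) * (X - C (Y b)) = X * X - C (Y a + Y b) * X + C (Y a * Y b) := by
        rw [C_add, C_mul]
        ring
      exact hquad ▸ add_mem (sub_mem (mul_mem hX hX) (mul_mem (hC hadd) hX)) (hC hmul)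
    · rw [Finset.mem_erase, Finset.mem_erase] at hj
      exact sub_mem hX (hC (hother j hj.2.1 hj.1))
  obtain ⟨x, hx⟩ := (lifts_iff_coeff_lifts _).1 ((lifts_iff_liftsRing _ _).2 hlift) i
  exact hx ▸ x.2

theorem isIntegral_of_coeff_prod_mem (S : Subalgebra k B) (Y : ι → B)
    (hS : ∀ i, (∏ j, (X - C (Y j))).coeff i ∈ S) (j : ι) : IsIntegral S (Y j) := by
  have hmonic : (∏ j, (X - C (Y j))).Monic := monic_prod_of_monic _ _ fun j _ => monic_X_sub_C _
  have hlift : ∏ j, (X - C (Y j)) ∈ lifts (algebraMap S B) :=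
    (lifts_iff_coeff_lifts _).2 fun i => ⟨⟨_, hS i⟩, rfl⟩
  obtain ⟨p, hp, -, hpmonic⟩ := lifts_and_natDegree_eq_and_monic hlift hmonic
  refine ⟨p, hpmonic, ?_⟩
  rw [eval₂_eq_eval_map, hp, eval_prod]
  exact Finset.prod_eq_zero (Finset.mem_univ j) (by simp)

theorem finite_of_adjoin_eq_top (S : Subalgebra k B) {s : Set B} (hs : s.Finite)
    (htop : Algebra.adjoin k s = ⊤) (hint : ∀ x ∈ s, IsIntegral S x) : Module.Finite S B := by
  have hfinite := Algebra.finite_adjoin_of_finite_of_isIntegral hs hint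
  have hle : Algebra.adjoin k s ≤ (Algebra.adjoin S s).restrictScalars k :=
    Algebra.adjoin_le Algebra.subset_adjoin
  have htop' : Algebra.adjoin S s = ⊤ := eq_top_iff.2 fun x _ => hle (htop ▸ Algebra.mem_top)
  rw [htop'] at hfinite
  exact Module.Finite.equiv (Subalgebra.topEquiv (R := S) (A := B)).toLinearEquiv

theorem IsFiniteOverCentral.of_mul_range_eq_top {H : Type*} [Ring H] [Algebra k H] (φ : B →ₐ[k] H)
    {S : Subalgebra k B} (hS : S.FG) [Module.Finite S B] (hcenter : S.map φ ≤ Subalgebra.center k H)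
    {V : Submodule k H} (hV : V.FG) (htop : V * Subalgebra.toSubmodule φ.range = ⊤) :
    IsFiniteOverCentral k H := by
  refine ⟨S.map φ, hS.map φ, hcenter, ?_⟩
  obtain ⟨s, hs, rfl⟩ := Submodule.fg_def.1 hV
  obtain ⟨t, ht, hspan⟩ := Submodule.fg_def.1 (Module.Finite.fg_top (R := S) (M := B))
  set W := Submodule.span (S.map φ) (Set.image2 (fun v b => v * φ b) s t)
  suffices W = ⊤ from ⟨Submodule.fg_def.2 ⟨_, hs.image2 _ ht, this⟩⟩
  have hmem (v : H) (hv : v ∈ Submodule.span k s) (b : B) : v * φ b ∈ W := by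
    have hb : b ∈ Submodule.span S t := hspan ▸ Submodule.mem_top
    induction hb using Submodule.span_induction with
    | zero => simp
    | add b c _ _ hb hc => exact map_add φ b c ▸ mul_add v _ _ ▸ add_mem hb hc
    | smul c b _ hb =>
      have hc : φ c ∈ S.map φ := ⟨c, c.2, rfl⟩
      have hcentral : v * φ (c • b) = φ c * (v * φ b) := by
        rw [Algebra.smul_def, map_mul, ← mul_assoc, ← mul_assoc]
        exact congrArg (· * φ b) (Subalgebra.mem_center_iff.1 (hcenter hc) v)
      exact hcentral ▸ W.smul_mem (⟨φ c, hc⟩ : S.map φ) hb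
    | mem b hb =>
      have hle : Submodule.span k s ≤ (W.restrictScalars k).comap (LinearMap.mulRight k (φ b)) :=
        Submodule.span_le.2 fun v hv => Submodule.subset_span ⟨v, hv, b, hb, rfl⟩
      exact hle hv
  have hle : Submodule.span k s * Subalgebra.toSubmodule φ.range ≤ W.restrictScalars k := by
    rw [Submodule.mul_le]
    rintro v hv _ ⟨b, rfl⟩
    exact hmem v hv b
  exact eq_top_iff.2 fun x _ => hle (htop ▸ Submodule.mem_top)

end Integrality

section CrossRelations

open Polynomial

variable {k H : Type*} [CommRing k] [Ring H] [Algebra k H] {ι : Type*}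

/-- The Bernstein cross relations of an affine Hecke algebra between a generator `t` of the finite
Hecke algebra and lattice elements `y j`, of which `t` interchanges `y a` and `y b` up to lower
order terms. The `y j` may also be the inverses of the standard lattice generators: then `a` and
`b` exchange their roles, see `CrossRelation.inv`. -/
structure CrossRelation (c : k) (t : H) (y : ι → H) (a b : ι) : Prop where
  ne : a ≠ b
  mul_left : y a * t = t * y b - c • y b
  mul_right : y b * t = t * y a + c • y b
  commute : ∀ j, j ≠ a → j ≠ b → Commute t (y j)

namespace CrossRelation

variable {c : k} {t : H} {y y' : ι → H} {a b : ι}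

theorem of_mul_mul_self {q : kˣ} (hab : a ≠ b) (hsq : t * t = ((q : k) - 1) • t + (q : k) • 1)
    (hmul : t * y a * t = (q : k) • y b) (hcomm : ∀ j, j ≠ a → j ≠ b → Commute t (y j)) :
    CrossRelation ((q : k) - 1) t y a b := by
  have hmul' : t * (y a * t) = (q : k) • y b := by rw [← mul_assoc, hmul]
  have hleft : t * (t * y a * t) = ((q : k) - 1) • (q : k) • y b + (q : k) • (y a * t) := by
    rw [mul_assoc, ← mul_assoc, hsq, add_mul, smul_mul_assoc, smul_mul_assoc, one_mul, hmul']
  have hright : t * y a * t * t = ((q : k) - 1) • (q : k) • y b + (q : k) • (t * y a) := by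
    rw [mul_assoc, hsq, mul_add, mul_smul_comm, mul_smul_comm, mul_one, hmul]
  rw [hmul, mul_smul_comm, smul_comm _ (q : k), ← smul_add] at hleft
  rw [hmul, smul_mul_assoc, smul_comm _ (q : k), ← smul_add] at hright
  have hinj {x z : H} : (q : k) • x = (q : k) • z → x = z := q.isUnit.smul_left_cancel.1
  exact ⟨hab, eq_sub_of_add_eq' (hinj hleft).symm, (hinj hright).trans (add_comm _ _), hcomm⟩

theorem inv (h : CrossRelation c t y a b) (hy : ∀ j, y j * y' j = 1) (hy' : ∀ j, y' j * y j = 1) :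
    CrossRelation c t y' b a where
  ne := h.ne.symm
  mul_left :=
    calc y' b * t = y' b * (y b * t - c • y b) * y' a := by
          rw [h.mul_right, add_sub_cancel_right, mul_assoc, mul_assoc, hy, mul_one]
      _ = y' b * y b * t * y' a - c • (y' b * y b * y' a) := by
          simp only [mul_sub, sub_mul, mul_smul_comm, smul_mul_assoc, mul_assoc]
      _ = t * y' a - c • y' a := by rw [hy', one_mul, one_mul]
  mul_right :=
    calc y' a * t = y' a * (y a * t + c • y b) * y' b := by
          rw [h.mul_left, sub_add_cancel, mul_assoc, mul_assoc, hy, mul_one]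
      _ = y' a * y a * t * y' b + c • (y' a * (y b * y' b)) := by
          simp only [mul_add, add_mul, mul_smul_comm, smul_mul_assoc, mul_assoc]
      _ = t * y' b + c • y' a := by rw [hy', hy, one_mul, mul_one]
  commute j hjb hja :=
    (show Commute t ((⟨y j, y' j, hy j, hy' j⟩ : Hˣ) : H) from h.commute j hja hjb).units_inv_right

theorem commute_add (h : CrossRelation c t y a b) : Commute t (y a + y b) := by
  change t * (y a + y b) = (y a + y b) * t
  rw [add_mul, h.mul_left, h.mul_right, mul_add]
  abel

theorem commute_mul (h : CrossRelation c t y a b) (hab : Commute (y a) (y b)) :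
    Commute t (y a * y b) :=
  calc t * (y a * y b) = t * y b * y a := by rw [hab.eq, mul_assoc]
    _ = (y a * t + c • y b) * y a := by rw [h.mul_left, sub_add_cancel]
    _ = y a * (t * y a + c • y b) := by
        rw [add_mul, mul_add, mul_assoc, smul_mul_assoc, mul_smul_comm, hab.eq]
    _ = y a * y b * t := by rw [← h.mul_right, mul_assoc]

variable {B : Type*} [CommRing B] [Algebra k B] {φ : B →ₐ[k] H} {Y : ι → B}

theorem commute_coeff_prod [Fintype ι] (h : CrossRelation c t (fun j => φ (Y j)) a b) (i : ℕ) :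
    Commute t (φ ((∏ j, (X - C (Y j))).coeff i)) := by
  let Q : Subring B := (Subring.centralizer {t}).comap φ
  have hQ {x : B} : x ∈ Q ↔ Commute t (φ x) := by
    simp [Q, Subring.mem_centralizer_iff, Commute, SemiconjBy]
  refine hQ.1 (coeff_prod_X_sub_C_mem Q Y h.ne (hQ.2 ?_) (hQ.2 ?_) (fun j hja hjb => hQ.2 ?_) i)
  · simpa only [map_add] using h.commute_add
  · simpa only [map_mul] using h.commute_mul ((Commute.all _ _).map φ)
  · exact h.commute j hja hjb

theorem exists_mul_eq_mul_add (h : CrossRelation c t (fun j => φ (Y j)) a b) (j : ι) :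
    ∃ x z, φ (Y j) * t = t * φ x + φ z := by
  by_cases hja : j = a
  · exact ⟨Y b, -(c • Y b), by rw [hja, h.mul_left, map_neg, map_smul, sub_eq_add_neg]⟩
  by_cases hjb : j = b
  · exact ⟨Y a, c • Y b, by rw [hjb, h.mul_right, map_smul]⟩
  · exact ⟨Y j, 0, by rw [map_zero, add_zero, (h.commute j hja hjb).eq]⟩

end CrossRelation

section MulRange

variable {B : Type*} [CommRing B] [Algebra k B] (φ : B →ₐ[k] H)

theorem exists_mul_eq_mul_add_of_adjoin {t : H} {s : Set B} (hs : Algebra.adjoin k s = ⊤)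
    (h : ∀ x ∈ s, ∃ y z, φ x * t = t * φ y + φ z) (x : B) :
    ∃ y z, φ x * t = t * φ y + φ z := by
  have hx : x ∈ Algebra.adjoin k s := hs.ge Algebra.mem_top
  induction hx using Algebra.adjoin_induction with
  | mem x hx => exact h x hx
  | algebraMap r => exact ⟨algebraMap k B r, 0, by simp [Algebra.commutes]⟩
  | add x x' _ _ hx hx' =>
    obtain ⟨y, z, hx⟩ := hx
    obtain ⟨y', z', hx'⟩ := hx'
    refine ⟨y + y', z + z', ?_⟩
    rw [map_add, add_mul, hx, hx', map_add, map_add, mul_add]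
    abel
  | mul x x' _ _ hx hx' =>
    obtain ⟨y, z, hx⟩ := hx
    obtain ⟨y', z', hx'⟩ := hx'
    refine ⟨y * y', z * y' + x * z', ?_⟩
    rw [map_mul, mul_assoc, hx', mul_add, ← mul_assoc, hx, map_add, map_mul, map_mul, map_mul,
      add_mul, mul_assoc, add_assoc]

theorem adjoin_mul_range_eq_top {τ : Set H} (htop : Algebra.adjoin k (τ ∪ φ.range) = ⊤)
    (h : ∀ t ∈ τ, ∀ x, ∃ y z, φ x * t = t * φ y + φ z) :
    Subalgebra.toSubmodule (Algebra.adjoin k τ) * Subalgebra.toSubmodule φ.range = ⊤ := by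
  set V := Algebra.adjoin k τ
  set W := Subalgebra.toSubmodule V * Subalgebra.toSubmodule φ.range
  have hmem {v : H} (hv : v ∈ V) (x : B) : v * φ x ∈ W := Submodule.mul_mem_mul hv ⟨x, rfl⟩
  have hone : 1 ∈ W := by simpa using hmem (one_mem V) 1
  have hle : Subalgebra.toSubmodule (Algebra.adjoin k (τ ∪ φ.range)) ≤ W := by
    refine adjoin_le_of_mul_mem hone fun g hg => ?_
    suffices W ≤ W.comap (LinearMap.mulRight k g) from this
    rw [Submodule.mul_le]
    rintro v hv _ ⟨x, rfl⟩
    change v * φ x * g ∈ W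
    rw [mul_assoc]
    obtain hg | ⟨x', rfl⟩ := hg
    · obtain ⟨y, z, hyz⟩ := h g hg x
      rw [hyz, mul_add, ← mul_assoc]
      exact add_mem (hmem (V.mul_mem hv (Algebra.subset_adjoin hg)) y) (hmem hv z)
    · exact map_mul φ x x' ▸ hmem hv (x * x')
  exact eq_top_iff.2 fun x _ => hle (htop.ge Algebra.mem_top)

end MulRange

theorem isFiniteOverCentral_of_crossRelation {B σ : Type*} [CommRing B] [Algebra k B] [Finite σ]
    [Finite ι] (φ : B →ₐ[k] H) {Y : σ → ι → B} (hY : Algebra.adjoin k (⋃ s, Set.range (Y s)) = ⊤)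
    {τ : Set H} (hτ : (Subalgebra.toSubmodule (Algebra.adjoin k τ)).FG)
    (htop : Algebra.adjoin k (τ ∪ φ.range) = ⊤)
    (hcross : ∀ t ∈ τ, ∀ s, ∃ c : k, ∃ a b, CrossRelation c t (fun j => φ (Y s j)) a b) :
    IsFiniteOverCentral k H := by
  have := Fintype.ofFinite ι
  let symmetric : Set B := ⋃ s, Set.range (∏ j, (X - C (Y s j))).coeff
  have hcentral : (Algebra.adjoin k symmetric).map φ ≤ Subalgebra.center k H := by
    rw [Subalgebra.map_le]
    refine Algebra.adjoin_le fun x hx => ?_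
    change φ x ∈ Subalgebra.center k H
    refine Subalgebra.mem_center_iff.2 fun g => ?_
    have hg : g ∈ Algebra.adjoin k (τ ∪ φ.range) := htop.ge Algebra.mem_top
    refine (Algebra.commute_of_mem_adjoin_of_forall_mem_commute hg fun g hg => ?_).eq.symm
    obtain hg | ⟨x', rfl⟩ := hg
    · obtain ⟨s, i, rfl⟩ := Set.mem_iUnion.1 hx
      obtain ⟨c, a, b, h⟩ := hcross g hg s
      exact (h.commute_coeff_prod i).symm
    · exact (Commute.all x x').map φ
  have hfinite : Module.Finite (Algebra.adjoin k symmetric) B := by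
    refine finite_of_adjoin_eq_top _ (Set.finite_iUnion fun s => Set.finite_range (Y s)) hY ?_
    simp only [Set.mem_iUnion]
    rintro _ ⟨s, j, rfl⟩
    exact isIntegral_of_coeff_prod_mem _ (Y s)
      (fun i => Algebra.subset_adjoin (Set.mem_iUnion_of_mem s (Set.mem_range_self i))) j
  have hFG : (Algebra.adjoin k symmetric).FG :=
    Subalgebra.fg_def.2 ⟨_, Set.finite_iUnion fun s => finite_range_coeff _, rfl⟩
  refine IsFiniteOverCentral.of_mul_range_eq_top φ hFG hcentral hτ ?_
  refine adjoin_mul_range_eq_top φ htop fun t ht => exists_mul_eq_mul_add_of_adjoin φ hY ?_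
  simp only [Set.mem_iUnion]
  rintro _ ⟨s, j, rfl⟩
  obtain ⟨c, a, b, h⟩ := hcross t ht s
  exact h.exists_mul_eq_mul_add j

open scoped IsMulCommutative in
theorem isFiniteOverCentral_of_commute_of_crossRelation {σ : Type*} [Finite σ] [Finite ι]
    {y : σ → ι → H} (hcomm : ∀ s s' j j', Commute (y s j) (y s' j')) {τ : Set H}
    (hτ : (Subalgebra.toSubmodule (Algebra.adjoin k τ)).FG)
    (htop : Algebra.adjoin k (τ ∪ ⋃ s, Set.range (y s)) = ⊤)
    (hcross : ∀ t ∈ τ, ∀ s, ∃ c : k, ∃ a b, CrossRelation c t (y s) a b) :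
    IsFiniteOverCentral k H := by
  let lattice : Set H := ⋃ s, Set.range (y s)
  have hlattice : ∀ x ∈ lattice, ∀ x' ∈ lattice, x * x' = x' * x := by
    simp only [lattice, Set.mem_iUnion]
    rintro _ ⟨s, j, rfl⟩ _ ⟨s', j', rfl⟩
    exact hcomm s s' j j'
  have := Algebra.isMulCommutative_adjoin k hlattice
  let Y (s : σ) (j : ι) : Algebra.adjoin k lattice :=
    ⟨y s j, Algebra.subset_adjoin (Set.mem_iUnion.2 ⟨s, j, rfl⟩)⟩
  have hY : ⋃ s, Set.range (Y s) = (Subtype.val ⁻¹' lattice : Set (Algebra.adjoin k lattice)) := by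
    ext x
    simp [lattice, Y, Subtype.ext_iff]
  refine isFiniteOverCentral_of_crossRelation (Y := Y) (Algebra.adjoin k lattice).val ?_ hτ ?_
    hcross
  · rw [hY, Algebra.adjoin_adjoin_coe_preimage]
  · refine eq_top_iff.2 (htop ▸ Algebra.adjoin_mono (Set.union_subset_union_right τ fun x hx => ?_))
    exact ⟨⟨x, Algebra.subset_adjoin hx⟩, rfl⟩

end CrossRelations

theorem mul_self_eq_of_quadratic {k H : Type*} [CommRing k] [Ring H] [Algebra k H] {t : H} {q : k}
    (h : (t - algebraMap k H q) * (t + 1) = 0) : t * t = (q - 1) • t + q • 1 := by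
  rw [Algebra.algebraMap_eq_smul_one, sub_mul, mul_add, mul_one, smul_mul_assoc, one_mul, smul_add,
    sub_eq_zero, ← eq_sub_iff_add_eq] at h
  rw [h, sub_smul, one_smul]
  abel

section AffineHecke

/-- The generator `T i` of the affine Hecke algebra, extended by `0` to the indices `i` out of
range. -/
noncomputable def heckeT (n : ℕ) (q : ℂˣ) (i : ℕ) : AffineHecke n q :=
  if h : i + 1 < n then RingQuot.mkAlgHom ℂ (AffineHeckeRel n q) (AffineHeckeGen.fT i h) else 0

/-- The lattice generator `y j` of the affine Hecke algebra. -/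
noncomputable def heckeY (n : ℕ) (q : ℂˣ) (j : Fin n) : AffineHecke n q :=
  RingQuot.mkAlgHom ℂ (AffineHeckeRel n q) (AffineHeckeGen.fy j)

/-- The inverse lattice generator `(y j)⁻¹` of the affine Hecke algebra. -/
noncomputable def heckeYInv (n : ℕ) (q : ℂˣ) (j : Fin n) : AffineHecke n q :=
  RingQuot.mkAlgHom ℂ (AffineHeckeRel n q) (AffineHeckeGen.fyInv j)

variable {n : ℕ} {q : ℂˣ}

theorem heckeT_of_lt {i : ℕ} (h : i + 1 < n) :
    heckeT n q i = RingQuot.mkAlgHom ℂ (AffineHeckeRel n q) (AffineHeckeGen.fT i h) :=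
  dif_pos h

theorem heckeT_mul_self {i : ℕ} (h : i + 1 < n) :
    heckeT n q i * heckeT n q i = ((q : ℂ) - 1) • heckeT n q i + (q : ℂ) • 1 := by
  have hrel := RingQuot.mkAlgHom_rel ℂ (AffineHeckeRel.quadratic (q := q) i h)
  rw [map_mul, map_sub, map_add, map_one, map_zero, AlgHom.commutes, ← heckeT_of_lt h] at hrel
  exact mul_self_eq_of_quadratic hrel

theorem isHeckeFamily_heckeT : IsHeckeFamily (n - 1) (q : ℂ) (heckeT n q) where
  mul_self i hi := heckeT_mul_self (Nat.add_lt_of_lt_sub hi)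
  braid i hi := by
    simpa only [map_mul, ← heckeT_of_lt] using
      RingQuot.mkAlgHom_rel ℂ (AffineHeckeRel.braid (q := q) i (Nat.add_lt_of_lt_sub hi))
  commute i j hij hj := by
    have hjn : j + 1 < n := Nat.add_lt_of_lt_sub hj
    have hin : i + 1 < n := by lia
    simpa only [Commute, SemiconjBy, map_mul, ← heckeT_of_lt] using
      RingQuot.mkAlgHom_rel ℂ (AffineHeckeRel.T_comm (q := q) i j hin hjn hij)

theorem heckeY_commute (j l : Fin n) : Commute (heckeY n q j) (heckeY n q l) := by
  simpa only [Commute, SemiconjBy, heckeY, map_mul] using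
    RingQuot.mkAlgHom_rel ℂ (AffineHeckeRel.y_comm (q := q) j l)

theorem heckeY_mul_heckeYInv (j : Fin n) : heckeY n q j * heckeYInv n q j = 1 := by
  simpa only [heckeY, heckeYInv, map_mul, map_one] using
    RingQuot.mkAlgHom_rel ℂ (AffineHeckeRel.y_mul_yInv (q := q) j)

theorem heckeYInv_mul_heckeY (j : Fin n) : heckeYInv n q j * heckeY n q j = 1 := by
  simpa only [heckeY, heckeYInv, map_mul, map_one] using
    RingQuot.mkAlgHom_rel ℂ (AffineHeckeRel.yInv_mul_y (q := q) j)

theorem heckeYInv_commute_of_commute {x : AffineHecke n q} {j : Fin n}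
    (h : Commute x (heckeY n q j)) : Commute x (heckeYInv n q j) :=
  (show Commute x (⟨_, _, heckeY_mul_heckeYInv j, heckeYInv_mul_heckeY j⟩ : (AffineHecke n q)ˣ)
    from h).units_inv_right

theorem crossRelation_heckeY {i : ℕ} (h : i + 1 < n) :
    CrossRelation ((q : ℂ) - 1) (heckeT n q i) (heckeY n q) ⟨i, Nat.lt_of_succ_lt h⟩
      ⟨i + 1, h⟩ := by
  refine .of_mul_mul_self (by simp) (heckeT_mul_self h) ?_ fun j hji hji' => ?_
  · simpa only [heckeY, map_mul, map_smul, ← heckeT_of_lt, ← Algebra.smul_def] using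
      RingQuot.mkAlgHom_rel ℂ (AffineHeckeRel.T_y_T (q := q) i h)
  · simpa only [Commute, SemiconjBy, heckeY, map_mul, ← heckeT_of_lt] using
      RingQuot.mkAlgHom_rel ℂ (AffineHeckeRel.T_y_comm (q := q) i h j (Fin.val_ne_of_ne hji)
        (Fin.val_ne_of_ne hji'))

theorem adjoin_heckeT_heckeY_heckeYInv :
    Algebra.adjoin ℂ (heckeT n q '' Set.Iio (n - 1) ∪
      ⋃ s, Set.range (![heckeY n q, heckeYInv n q] s)) = ⊤ := by
  have hmap := congrArg (Subalgebra.map (RingQuot.mkAlgHom ℂ (AffineHeckeRel n q)))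
    (FreeAlgebra.adjoin_range_ι ℂ (AffineHeckeGen n))
  rw [AlgHom.map_adjoin, Algebra.map_top,
    (AlgHom.range_eq_top _).2 (RingQuot.mkAlgHom_surjective ℂ (AffineHeckeRel n q))] at hmap
  refine eq_top_iff.2 (hmap ▸ Algebra.adjoin_mono ?_)
  rintro _ ⟨_, ⟨g, rfl⟩, rfl⟩
  cases g with
  | T i hi => exact .inl ⟨i, Nat.lt_sub_of_add_lt hi, heckeT_of_lt hi⟩
  | y j => exact .inr (Set.mem_iUnion.2 ⟨0, j, rfl⟩)
  | yInv j => exact .inr (Set.mem_iUnion.2 ⟨1, j, rfl⟩)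

theorem isFiniteOverCentral_affineHecke (n : ℕ) (q : ℂˣ) :
    IsFiniteOverCentral ℂ (AffineHecke n q) := by
  have hcomm (j l : Fin n) : Commute (heckeY n q j) (heckeYInv n q l) :=
    heckeYInv_commute_of_commute (heckeY_commute j l)
  refine isFiniteOverCentral_of_commute_of_crossRelation (y := ![heckeY n q, heckeYInv n q]) ?_
    (isHeckeFamily_heckeT.adjoin_fg le_rfl) adjoin_heckeT_heckeY_heckeYInv ?_
  · simp only [Fin.forall_fin_two]
    exact ⟨⟨heckeY_commute, hcomm⟩, fun j l => (hcomm l j).symm,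
      fun j l => heckeYInv_commute_of_commute (hcomm l j).symm⟩
  · rintro _ ⟨i, hi, rfl⟩
    have hcross := crossRelation_heckeY (q := q) (Nat.add_lt_of_lt_sub hi)
    exact Fin.forall_fin_two.2 ⟨⟨_, _, _, hcross⟩,
      _, _, _, hcross.inv heckeY_mul_heckeYInv heckeYInv_mul_heckeY⟩

end AffineHecke

theorem mainTheorem5_general {A : Type} [Ring A] [IsNoetherianRing (Zc A)] [Module.Finite (Zc A) A]
    (J : Ideal (Zc A)) [J.IsMaximal] (π₁ π₂ : ModuleCat.{0} A) [Module.Finite A π₁]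
    [Module.Finite A π₂] :
    ∃ (_ : Abelian (CHat J)) (_ : HasExt.{1} (CHat J))
      (h₁ : IsCHat J (completion J π₁)) (h₂ : IsCHat J (completion J π₂)), ∀ i : ℕ,
      (∃ e : ZHat J ⊗[Zc A] Ext π₁ π₂ i ≃+ Ext π₁ (completion J π₂) i,
        ∀ (r : ZHat J) x,
          e (r • x) = (e x).comp (Ext.mk₀ (completionScalar J π₂ r)) (add_zero i)) ∧
      (∃ e : ZHat J ⊗[Zc A] Ext π₁ π₂ i ≃+ Ext (completionObj J π₁ h₁) (completionObj J π₂ h₂) i,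
        ∀ (r : ZHat J) x,
          e (r • x) = (e x).comp (Ext.mk₀ (completionObjScalar J π₂ h₂ r)) (add_zero i)) ∧
      ((IsFiniteLength A π₁ ∧ IsCHat J π₁) ∨ (IsFiniteLength A π₂ ∧ IsCHat J π₂) →
        ∃ e : Ext π₁ π₂ i ≃+ Ext (completionObj J π₁ h₁) (completionObj J π₂ h₂) i,
          ∀ (z : Zc A) x,
            e (z • x) = (e x).comp
              (Ext.mk₀ (completionObjScalar J π₂ h₂ (algebraMap _ (ZHat J) z)))
              (add_zero i)) := by
  have h₁ : IsCHat J (completion J π₁) := isCHat_completion J π₁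
  have h₂ : IsCHat J (completion J π₂) := isCHat_completion J π₂
  refine ⟨inferInstance, HasExt.standard _, h₁, h₂, fun i => ?_⟩
  let _ : HasExt.{1} (CHat J) := HasExt.standard _
  exact ⟨exists_ext_completion_equiv J π₁ π₂ i, exists_ext_chat_equiv J π₁ π₂ h₁ h₂ i,
    exists_ext_chat_equiv_of_isFiniteLength J π₁ π₂ h₁ h₂ i⟩

theorem mainTheorem5 {k : ℕ} (n : Fin k → ℕ) (q : Fin k → ℂˣ)
    (J : Ideal (Zc (BlockHecke n q))) (hJ : J.IsMaximal)
    (π₁ π₂ : ModuleCat.{0} (BlockHecke n q))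
    (hπ₁ : Module.Finite (BlockHecke n q) π₁) (hπ₂ : Module.Finite (BlockHecke n q) π₂) :
    ∃ (_ : Abelian (CHat J)) (_ : HasExt.{1} (CHat J))
      (h₁ : IsCHat J (completion J π₁)) (h₂ : IsCHat J (completion J π₂)), ∀ i : ℕ,
      (∃ e : ZHat J ⊗[Zc (BlockHecke n q)] Ext π₁ π₂ i ≃+ Ext π₁ (completion J π₂) i,
        ∀ (r : ZHat J) x,
          e (r • x) = (e x).comp (Ext.mk₀ (completionScalar J π₂ r)) (add_zero i)) ∧
      (∃ e : ZHat J ⊗[Zc (BlockHecke n q)] Ext π₁ π₂ i ≃+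
          Ext (completionObj J π₁ h₁) (completionObj J π₂ h₂) i,
        ∀ (r : ZHat J) x,
          e (r • x) = (e x).comp (Ext.mk₀ (completionObjScalar J π₂ h₂ r)) (add_zero i)) ∧
      (((IsFiniteLength (BlockHecke n q) π₁ ∧ IsCHat J π₁) ∨
          (IsFiniteLength (BlockHecke n q) π₂ ∧ IsCHat J π₂)) →
        Module.Finite ℂ (Ext π₁ π₂ i) →
        ∃ e : Ext π₁ π₂ i ≃+ Ext (completionObj J π₁ h₁) (completionObj J π₂ h₂) i,
          ∀ (z : Zc (BlockHecke n q)) x,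
            e (z • x) = (e x).comp
              (Ext.mk₀ (completionObjScalar J π₂ h₂ (algebraMap _ (ZHat J) z)))
              (add_zero i)) := by
  have hcentral : IsFiniteOverCentral ℂ (BlockHecke n q) :=
    .piTensorProduct fun i => isFiniteOverCentral_affineHecke (n i) (q i)
  have := hcentral.module_finite
  have := hcentral.isNoetherianRing
  obtain ⟨habelian, hext, h₁, h₂, hiso⟩ := mainTheorem5_general J π₁ π₂
  exact ⟨habelian, hext, h₁, h₂, fun i =>
    ⟨(hiso i).1, (hiso i).2.1, fun hlength _ => (hiso i).2.2 hlength⟩⟩
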